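/- Let $G=(V,\to)$ be a finite directed graph (self-loops allowed) and let $D$ be a depth-first forest of $G$, that is, the forest of discovery edges of some complete depth-first search of $G$, together with the order of discovery (the DFN). An edge $u\to v$ is a tree edge if $u$ is the parent of $v$ in $D$, a back edge if $v$ is an ancestor of $u$ in $D$ (every vertex being an ancestor of itself), and a cross/forward edge otherwise; let $B$ be the set of back edges. The lowest common ancestor (LCA) of two vertices in different trees of $D$ is a virtual root above all trees. Every vertex $h$ has a possible new element $x_h\notin V$, the exit created for the head $h$. Both algorithms return a 4-tuple $(V,X,\rightharpoonup,\rightsquigarrow)$ of vertices, exits, scheduling constraints and stabilization constraints. **Top-down algorithm** $\mathrm{ConstructWPO}^{TD}(G,D)$. For each maximal strongly connected component $G_i$ of $G$, with vertex set $V_i$, compute a 4-tuple and an exit $x_i$ by $\mathrm{sccWPO}(G_i,D)$; return the componentwise union of these 4-tuples, with the pairs $x_i\rightharpoonup v$ added for all edges $u\to v$ with $u\in V_i$, $v\in V_j$, $i\ne j$. Here $\mathrm{sccWPO}(G,D)$, for strongly connected $G=(V,\to)$, takes the vertex $h$ of minimum DFN. If no edge enters $h$, it returns $(\{h\},\emptyset,\emptyset,\emptyset)$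 with exit $h$. Otherwise, if $V=\{h\}$, it returns $(\{h\},\{x_h\},\{(h,x_h)\},\{(x_h,h)\})$ with exit $x_h$. Otherwise it puts $V'=(V\cup\{x_h\})\setminus\{h\}$ and ${\to'}={\to}|_{V'}\cup\{(v,x_h): v\in V,\ v\to h\}$, obtains $(V',X',\rightharpoonup',\rightsquigarrow')$ from the recursive call on $(V',\to')$ and $D|_{V'}$, and returns $(V,\ X'\cup\{x_h\},\ {\rightharpoonup'}\cup\{(h,v):v\in V,\ h\to v\},\ {\rightsquigarrow'}\cup\{(x_h,h)\})$ with exit $x_h$. **Bottom-up algorithm** $\mathrm{ConstructWPO}^{BU}(G,D,\mathit{false})$. Start with $X={\rightharpoonup}={\rightsquigarrow}=\emptyset$ and $\mathrm{rep}(v)=\mathrm{exit}[v]=v$ for all $v$. Remove all cross/forward edges from $\to$, storing $(u,v)$ in $R[\mathrm{LCA}(u,v)]$, and let $O[v]$ be the set of the remaining non-back edges into $v$. *Restoring at $h$* means: for each $(u,v)\in R[h]$, add $(u,\mathrm{rep}(v))$ to $\to$ and $(u,v)$ to $O[\mathrm{rep}(v)]$. For each $h\in V$ in descending DFN, restore at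 $h$ and then do the following. Let $P=\{\mathrm{rep}(p):(p,h)\in B\}$, $N=\emptyset$, and start a worklist with $P\setminus\{h\}$. While the worklist is non-empty, move some $v$ from it to $N$, and for each $(p,v)\in{\to}\setminus B$ put $\mathrm{rep}(p)$ on the worklist unless it is $h$, in $N$, or already there. If $P\neq\emptyset$: add $\mathrm{exit}[\mathrm{rep}(u)]\rightharpoonup v'$ for all $v\in N$ and $(u,v')\in O[v]$; add the new exit $x_h$ to $X$; add $\mathrm{exit}[\mathrm{rep}(p)]\rightharpoonup x_h$ for all $p\in P$, and $x_h\rightsquigarrow h$; set $\mathrm{exit}[h]:=x_h$; and merge the classes of all $v\in N$ with the class of $h$, with representative $h$. After the loop, restore at the virtual root, add $\mathrm{exit}[\mathrm{rep}(u)]\rightharpoonup v'$ for all $v$ with $\mathrm{rep}(v)=v$ and $(u,v')\in O[v]$, and return $(V,X,\rightharpoonup,\rightsquigarrow)$. Call $h\in V$ a *looped head* if $h\to h$ and there is also a back edge $p\to h$ with $p\neq h$. **Theorem.** The bottom-up algorithm (with $\mathit{lift}=\mathit{false}$) has a terminating run on $G$ and $D$. Whatever choices are made from the worklists, the 4-tuple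 that it returns has the same vertices $V$, the same exits $X$ and the same stabilization constraints $\rightsquigarrow$ as the one returned by $\mathrm{ConstructWPO}^{TD}(G,D)$, and the two relations $\rightharpoonup$ agree on all pairs other than $(h,h)$ and $(h,x_h)$ with $h$ a looped head. In particular, if there is no looped head (for example, if $G$ has no self-loops), then both algorithms construct the same WPO $(V,X,\rightharpoonup,\rightsquigarrow)$. -/

import Mathlib

/-! ## Depth-first search, depth-first forests, classification of edges -/

/-- A depth-first forest: the list of the vertices in the order of their discovery, and for each
vertex its parent (`none` at the roots). -/
structure DFForest (V : Type*) where
  order : List V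
  parent : V → Option V

/-- A state of a depth-first search: the vertices discovered so far (in the order of discovery),
the stack of vertices being explored (innermost first), and the parents recorded so far. -/
structure DFSState (V : Type*) where
  disc : List V
  stack : List V
  parent : V → Option V

/-- One step of a (nondeterministic) depth-first search of the directed graph with edge
relation `E`. -/
inductive DFSStep {V : Type*} (E : V → V → Prop) : DFSState V → DFSState V → Prop
  /-- The stack is empty: start a new tree at any undiscovered vertex. -/
  | root (l : List V) (par : V → Option V) (v : V) (hv : v ∉ l) :
      DFSStep E ⟨l, [], par⟩ ⟨l ++ [v], [v], par⟩
  /-- Discover `v` along the edge `u → v` out of the innermost vertex `u`. -/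
  | discover (l : List V) (st : List V) (par par' : V → Option V) (u v : V)
      (huv : E u v) (hv : v ∉ l) (hpar : par' v = some u) (hpar' : ∀ w, w ≠ v → par' w = par w) :
      DFSStep E ⟨l, u :: st, par⟩ ⟨l ++ [v], v :: u :: st, par'⟩
  /-- All successors of the innermost vertex `u` are discovered: `u` is finished. -/
  | finish (l : List V) (st : List V) (par : V → Option V) (u : V)
      (hu : ∀ v, E u v → v ∈ l) :
      DFSStep E ⟨l, u :: st, par⟩ ⟨l, st, par⟩

/-- `D` is a depth-first forest of the graph: it is recorded by some complete depth-first search. -/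
def IsDFF {V : Type*} (E : V → V → Prop) (D : DFForest V) : Prop :=
  Relation.ReflTransGen (DFSStep E) ⟨[], [], fun _ => none⟩ ⟨D.order, [], D.parent⟩ ∧
    ∀ v, v ∈ D.order

namespace DFForest

variable {V : Type*} (D : DFForest V)

open Classical in
/-- The depth-first number: the position in the order of discovery. -/
noncomputable def dfn (v : V) : ℕ := D.order.idxOf v

/-- `a` is an ancestor of `v` (every vertex is an ancestor of itself). -/
def Anc (a v : V) : Prop := Relation.ReflTransGen (fun x y => D.parent y = some x) a v

/-- The depth of a vertex, counted as its number of ancestors (one for a root). -/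
noncomputable def depth (v : V) : ℕ := {a | D.Anc a v}.ncard

/-- `a` is a lowest common ancestor of `u` and `v`. -/
def IsLCA (a u v : V) : Prop :=
  D.Anc a u ∧ D.Anc a v ∧ ∀ b, D.Anc b u → D.Anc b v → D.depth b ≤ D.depth a

/-- `u → v` is a back edge (`v` is an ancestor of `u`; in particular self-loops are back edges). -/
def IsBack (E : V → V → Prop) (u v : V) : Prop := E u v ∧ D.Anc v u

/-- `u → v` is a cross or forward edge: neither a tree edge nor a back edge. -/
def IsCrossFwd (E : V → V → Prop) (u v : V) : Prop :=
  E u v ∧ D.parent v ≠ some u ∧ ¬ D.Anc v u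

end DFForest

/-! ## The output of the algorithms -/

/-- The elements of `V ∪ X`: a vertex `v`, or the new exit `x_h` created for the head `h`. -/
inductive Node (V : Type*)
  | vtx (v : V)
  | exit (h : V)

/-- A 4-tuple `(V, X, ⇀, ⇢)`: vertices, exits, scheduling constraints, stabilization
constraints. -/
@[ext] structure WPOTuple (V : Type*) where
  verts : Set (Node V)
  exits : Set (Node V)
  sched : Node V → Node V → Prop
  stab : Node V → Node V → Prop

/-- What the construction for a strongly connected graph returns: a 4-tuple, a head, an exit. -/
structure SCCResult (V : Type*) where
  wpo : WPOTuple V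
  head : Node V
  exit : Node V

/-! ## The top-down recursive construction -/

/-- A directed graph whose vertices are among the elements of `Node V` (the recursion of the
top-down algorithm works on graphs that contain exits created before). -/
structure NGraph (V : Type*) where
  verts : Set (Node V)
  edge : Node V → Node V → Prop

namespace NGraph

variable {V : Type*} (G : NGraph V)

/-- The subgraph induced by a set of vertices. -/
def restrict (C : Set (Node V)) : NGraph V where
  verts := G.verts ∩ C
  edge a b := G.edge a b ∧ a ∈ C ∧ b ∈ C

/-- `C` is the vertex set of a strongly connected subgraph. -/
def IsSC (C : Set (Node V)) : Prop :=
  C ⊆ G.verts ∧ C.Nonempty ∧ ∀ u ∈ C, ∀ v ∈ C, Relation.ReflTransGen G.edge u v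

/-- `C` is the vertex set of a maximal strongly connected component. -/
def IsMaxSCC (C : Set (Node V)) : Prop := Maximal G.IsSC C

theorem IsMaxSCC.restrict_nonempty {G : NGraph V} {C : Set (Node V)} (hC : G.IsMaxSCC C) :
    (G.restrict C).verts.Nonempty := by
  obtain ⟨x, hx⟩ := hC.1.2.1
  exact ⟨x, hC.1.1 hx, hx⟩

/-- The graph in which the head `h` is replaced by its exit `x_h`, which becomes the target of the
edges into `h`. -/
def breakHead (h : V) : NGraph V where
  verts := (G.verts ∪ {Node.exit h}) \ {Node.vtx h}
  edge a b :=
    (G.edge a b ∧ a ∈ (G.verts ∪ {Node.exit h}) \ {Node.vtx h} ∧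
      b ∈ (G.verts ∪ {Node.exit h}) \ {Node.vtx h}) ∨
    (a ∈ G.verts ∧ G.edge a (Node.vtx h) ∧ b = Node.exit h)

/-- The number of vertices of the graph that are not exits (used only for termination). -/
noncomputable def size : ℕ := {v : V | Node.vtx v ∈ G.verts}.ncard

theorem size_restrict_le [Finite V] (C : Set (Node V)) : (G.restrict C).size ≤ G.size :=
  Set.ncard_le_ncard (fun _ hv => hv.1) (Set.toFinite _)

theorem size_breakHead_lt [Finite V] (h : V) (hh : Node.vtx h ∈ G.verts) :
    (G.breakHead h).size < G.size := by
  apply Set.ncard_lt_ncard _ (Set.toFinite _)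
  constructor
  · rintro v ⟨hv | hv, _⟩
    · exact hv
    · cases hv
  · intro hsub
    exact (hsub hh).2 rfl

/-- The graph `(V, E)` itself. -/
def ofRel (E : V → V → Prop) : NGraph V where
  verts := Set.range Node.vtx
  edge a b := ∃ u v, E u v ∧ a = Node.vtx u ∧ b = Node.vtx v

end NGraph

/-- Depth-first numbers on `Node V`. Exits do not belong to the forest; they get the number `⊤`,
which is compared only in graphs without other vertices. -/
noncomputable def DFForest.nodeDFN {V : Type*} (D : DFForest V) : Node V → WithTop ℕ
  | Node.vtx v => (D.dfn v : WithTop ℕ)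
  | Node.exit _ => ⊤

/-- The vertex with minimum depth-first number. -/
noncomputable def NGraph.minDFN {V : Type*} (D : DFForest V) (G : NGraph V)
    (hG : G.verts.Nonempty) : Node V :=
  Function.argminOn D.nodeDFN G.verts hG

theorem NGraph.minDFN_mem {V : Type*} (D : DFForest V) (G : NGraph V) (hG : G.verts.Nonempty) :
    G.minDFN D hG ∈ G.verts :=
  Function.argminOn_mem _ _ _

/-- `trivialWPO(h)`. -/
def trivialWPO {V : Type*} (h : Node V) : SCCResult V where
  wpo := ⟨{h}, ∅, fun _ _ => False, fun _ _ => False⟩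
  head := h
  exit := h

/-- `self-loopWPO(h)`. -/
def selfLoopWPO {V : Type*} (h : V) : SCCResult V where
  wpo :=
    ⟨{Node.vtx h}, {Node.exit h},
      fun a b => a = Node.vtx h ∧ b = Node.exit h,
      fun a b => a = Node.exit h ∧ b = Node.vtx h⟩
  head := Node.vtx h
  exit := Node.exit h

/-- The merge of the results `r C` for the maximal SCCs `C` of `G`, with the scheduling constraints
for the edges between different maximal SCCs. -/
def connectTD {V : Type*} (G : NGraph V) (r : {C : Set (Node V) // G.IsMaxSCC C} → SCCResult V) :
    WPOTuple V where
  verts := {a | ∃ C, a ∈ (r C).wpo.verts}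
  exits := {a | ∃ C, a ∈ (r C).wpo.exits}
  sched a b := (∃ C, (r C).wpo.sched a b) ∨
    ∃ C C' u, C ≠ C' ∧ G.edge u b ∧ u ∈ C.1 ∧ b ∈ C'.1 ∧ a = (r C).exit
  stab a b := ∃ C, (r C).wpo.stab a b

/-- The result of `sccWPO` for a strongly connected graph `G` with head `h` and at least two
vertices, from the 4-tuple `W'` of the modified graph. -/
def extendTD {V : Type*} (G : NGraph V) (h : V) (W' : WPOTuple V) : SCCResult V where
  wpo :=
    ⟨G.verts, W'.exits ∪ {Node.exit h},
      fun a b => W'.sched a b ∨ (a = Node.vtx h ∧ b ∈ G.verts ∧ G.edge (Node.vtx h) b),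
      fun a b => W'.stab a b ∨ (a = Node.exit h ∧ b = Node.vtx h)⟩
  head := Node.vtx h
  exit := Node.exit h

open Classical in
mutual

/-- `ConstructWPO^TD(G, D)`, on graphs over `Node V`. -/
noncomputable def constructTD {V : Type*} [Finite V] (D : DFForest V) (G : NGraph V) :
    WPOTuple V :=
  connectTD G fun C => sccWPO D (G.restrict C.1) C.2.restrict_nonempty
termination_by (G.size, 1)
decreasing_by
  rcases (G.size_restrict_le C.1).lt_or_eq with h | h
  · exact Prod.Lex.left _ _ h
  · rw [h]; exact Prod.Lex.right _ Nat.zero_lt_one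

/-- `sccWPO(G, D)`, for strongly connected graphs over `Node V`. The head is an exit created before
only if the graph consists of this exit alone, without edges. -/
noncomputable def sccWPO {V : Type*} [Finite V] (D : DFForest V) (G : NGraph V)
    (hG : G.verts.Nonempty) : SCCResult V :=
  match hh : G.minDFN D hG with
  | Node.exit x => trivialWPO (Node.exit x)
  | Node.vtx h =>
    if ¬ ∃ v ∈ G.verts, G.edge v (Node.vtx h) then trivialWPO (Node.vtx h)
    else if G.verts.ncard = 1 then selfLoopWPO h
    else extendTD G h (constructTD D (G.breakHead h))
termination_by (G.size, 0)
decreasing_by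
  exact Prod.Lex.left _ _ (G.size_breakHead_lt h (hh ▸ G.minDFN_mem D hG))

end

/-- `ConstructWPO^TD(G, D)` for the graph `G = (V, E)`. -/
noncomputable def ConstructWPOTD {V : Type*} [Finite V] (E : V → V → Prop) (D : DFForest V) :
    WPOTuple V :=
  constructTD D (NGraph.ofRel E)

/-! ## The bottom-up iterative construction -/

/-- The variables of the bottom-up algorithm: the current edges, the sets `X`, `⇀`, `⇢`, and the
maps `rep`, `exit`, `R` and `O`. The map `R` is indexed by `Option V`; the index `none` is a
virtual root above all trees of the forest, the lowest common ancestor of two vertices that lie in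
different trees. -/
structure BUState (V : Type*) where
  edge : V → V → Prop
  exits : Set (Node V)
  sched : Node V → Node V → Prop
  stab : Node V → Node V → Prop
  rep : V → V
  exit : V → Node V
  R : Option V → Set (V × V)
  O : V → Set (V × V)

namespace BUState

variable {V : Type*}

/-- `removeAllCrossForwardEdges()`: cross and forward edges are removed and stored at their lowest
common ancestors. -/
def removeAllCrossForwardEdges (E : V → V → Prop) (D : DFForest V) (s : BUState V) : BUState V :=
  { s with
    edge := fun u v => s.edge u v ∧ ¬ D.IsCrossFwd E u v
    R := fun a => s.R a ∪
      {e | D.IsCrossFwd E e.1 e.2 ∧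
        match a with
        | some h => D.IsLCA h e.1 e.2
        | none => ¬ ∃ b, D.Anc b e.1 ∧ D.Anc b e.2} }

/-- The initialization of all maps but `O`. -/
def start (E : V → V → Prop) : BUState V where
  edge := E
  exits := ∅
  sched _ _ := False
  stab _ _ := False
  rep v := v
  exit v := Node.vtx v
  R _ := ∅
  O _ := ∅

/-- The state before the main loop. -/
def init (E : V → V → Prop) (D : DFForest V) : BUState V :=
  let s := removeAllCrossForwardEdges E D (start E)
  { s with O := fun v => {e | e.2 = v ∧ s.edge e.1 v ∧ ¬ D.IsBack E e.1 v} }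

/-- `restoreCrossForwardEdges(h)`. -/
def restoreCrossForwardEdges (h : Option V) (s : BUState V) : BUState V :=
  { s with
    edge := fun u w => s.edge u w ∨ ∃ v, (u, v) ∈ s.R h ∧ w = s.rep v
    O := fun w => s.O w ∪ {e | e ∈ s.R h ∧ s.rep e.2 = w} }

/-- The representatives of the sources of the back edges into `h`. -/
def backReps (E : V → V → Prop) (D : DFForest V) (h : V) (s : BUState V) : Set V :=
  {q | ∃ p, D.IsBack E p h ∧ q = s.rep p}

/-- One round of the worklist loop: a pair `(W, N)` of the worklist and the set of the nested
representatives found so far is updated for some `v` in the worklist. -/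
inductive SearchStep (E : V → V → Prop) (D : DFForest V) (h : V) (s : BUState V) :
    Set V × Set V → Set V × Set V → Prop
  | pop (W N : Set V) (v : V) (hv : v ∈ W) :
      SearchStep E D h s (W, N)
        ((W \ {v}) ∪ {q | ∃ p, s.edge p v ∧ ¬ D.IsBack E p v ∧ q = s.rep p ∧
            q ∉ (N ∪ {v}) ∪ {h} ∪ (W \ {v})},
          N ∪ {v})

/-- `findNestedSCCs(h)` may return `N, P`. -/
def FindNestedSCCs (E : V → V → Prop) (D : DFForest V) (h : V) (s : BUState V)
    (N P : Set V) : Prop :=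
  P = s.backReps E D h ∧
    Relation.ReflTransGen (SearchStep E D h s) (P \ {h}, ∅) (∅, N)

/-- The scheduling constraints added for a representative `v`: from the exits of the sources of the
original edges recorded in `O[v]` to their original targets, and, if `lift` is set, also to `v`. -/
def newSched (E : V → V → Prop) (D : DFForest V) (lift : Bool) (s : BUState V) (v : V)
    (a b : Node V) : Prop :=
  (∃ u v', (u, v') ∈ s.O v ∧ a = s.exit (s.rep u) ∧ b = Node.vtx v') ∨
  (lift = true ∧ ∃ u, s.edge u v ∧ ¬ D.IsBack E u v ∧ a = s.exit (s.rep u) ∧ b = Node.vtx v)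

open Classical in
/-- The representatives after `merge(v, h)` for all `v ∈ N`. -/
noncomputable def mergeAll (s : BUState V) (N : Set V) (h : V) (w : V) : V :=
  if ∃ v ∈ N, s.rep w = s.rep v ∨ s.rep w = s.rep h then h else s.rep w

open Classical in
/-- The effect of `constructWPOForSCC(h)` when `findNestedSCCs(h)` returned `N, P` with `P ≠ ∅`. -/
noncomputable def addComponent (E : V → V → Prop) (D : DFForest V) (lift : Bool) (h : V)
    (N P : Set V) (s : BUState V) : BUState V :=
  { s with
    exits := s.exits ∪ {Node.exit h}
    sched := fun a b => s.sched a b ∨ (∃ v ∈ N, s.newSched E D lift v a b) ∨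
      (∃ p ∈ P, a = s.exit (s.rep p) ∧ b = Node.exit h)
    stab := fun a b => s.stab a b ∨ (a = Node.exit h ∧ b = Node.vtx h)
    exit := Function.update s.exit h (Node.exit h)
    rep := s.mergeAll N h }

/-- `constructWPOForSCC(h)` may lead from the state `s` to the state `t`. -/
def ConstructWPOForSCC (E : V → V → Prop) (D : DFForest V) (lift : Bool) (h : V)
    (s t : BUState V) : Prop :=
  ∃ N P, FindNestedSCCs E D h s N P ∧
    ((P = ∅ ∧ t = s) ∨ (P ≠ ∅ ∧ t = s.addComponent E D lift h N P))

/-- The main loop, over a list of vertices. -/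
inductive MainLoop (E : V → V → Prop) (D : DFForest V) (lift : Bool) :
    List V → BUState V → BUState V → Prop
  | nil (s : BUState V) : MainLoop E D lift [] s s
  | cons (h : V) (l : List V) (s t s' : BUState V)
      (hstep : ConstructWPOForSCC E D lift h (s.restoreCrossForwardEdges (some h)) t)
      (hrest : MainLoop E D lift l t s') : MainLoop E D lift (h :: l) s s'

/-- `connectWPOsOfMaximalSCCs()`, and the returned 4-tuple. -/
def connectWPOsOfMaximalSCCs (E : V → V → Prop) (D : DFForest V) (lift : Bool)
    (s : BUState V) : WPOTuple V where
  verts := Set.range Node.vtx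
  exits := s.exits
  sched a b := s.sched a b ∨ ∃ v, s.rep v = v ∧ s.newSched E D lift v a b
  stab := s.stab

end BUState

/-- `ConstructWPO^BU(G, D, lift)` for the graph `G = (V, E)` may return `W`: the vertices are
processed in the order of descending depth-first number, then the edges between different trees
(stored at the virtual root) are restored and the WPOs of the maximal SCCs are connected. -/
def ConstructWPOBU {V : Type*} (E : V → V → Prop) (D : DFForest V) (lift : Bool)
    (W : WPOTuple V) : Prop :=
  ∃ s, BUState.MainLoop E D lift D.order.reverse (BUState.init E D) s ∧
    W = (s.restoreCrossForwardEdges none).connectWPOsOfMaximalSCCs E D lift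

/-- `h` has a self-loop and is also the target of a back edge from another vertex, that is, `h` is
the head of a component with at least two vertices and carries a self-loop. -/
def IsLoopedHead {V : Type*} (E : V → V → Prop) (D : DFForest V) (h : V) : Prop :=
  E h h ∧ ∃ p, p ≠ h ∧ D.IsBack E p h

/-!
The loop body of a head `h` is the set of descendants of `h` that can reach `h` without leaving the
subtree of `h`. Two loop bodies are nested or disjoint. They are the strongly connected components
with an edge that the top-down recursion meets, up to the exits by which it has replaced the heads
of larger bodies. After the bottom-up algorithm has treated the vertices of depth-first number at
least `k`, the classes of `rep` are the maximal loop bodies with a head of number at least `k`, and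
the singletons outside them, whatever the order of the worklist searches. Hence both outputs have a
closed form, in which every head contributes the scheduling constraints for the edges inside its
body that join different smaller bodies, and the edges joining different maximal bodies contribute
theirs. The two contributions of a head `h` differ only for a self-loop at the head of a body with
at least two vertices: as an edge out of `h` it gives `(h, h)` top-down, and as a back edge to `h`
it gives `(h, x_h)` bottom-up.
-/

theorem reflTransGen_and_of_between {α : Type*} {r : α → α → Prop} {P : α → Prop} {a b : α}
    (hab : Relation.ReflTransGen r a b)
    (hP : ∀ c, Relation.ReflTransGen r a c → Relation.ReflTransGen r c b → P c) :
    Relation.ReflTransGen (fun x y => r x y ∧ P x ∧ P y) a b := by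
  induction hab using Relation.ReflTransGen.head_induction_on with
  | refl => exact .refl
  | head hac hcb ih =>
    exact .head ⟨hac, hP _ .refl (hcb.head hac), hP _ (.single hac) hcb⟩
      (ih fun c hc hcb => hP c (hc.head hac) hcb)

/-! ### Depth-first searches -/

namespace DFForest

variable {V : Type*}

/-- The properties of a depth-first forest on which the comparison of the two constructions rests.
They are weaker than `IsDFF`: the order of discovery need not list the subtrees contiguously. -/
structure IsDepthFirst (E : V → V → Prop) (D : DFForest V) : Prop where
  nodup : D.order.Nodup
  mem_order : ∀ v, v ∈ D.order
  edge_of_parent : ∀ {u v}, D.parent v = some u → E u v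
  dfn_lt_of_parent : ∀ {u v}, D.parent v = some u → D.dfn u < D.dfn v
  anc_of_edge : ∀ {a u v}, D.Anc a u → E u v → D.dfn a ≤ D.dfn v → D.Anc a v

theorem dfn_lt_of_mem_of_notMem {D : DFForest V} {l : List V} {u v : V}
    (hl : l ++ [v] <+: D.order) (hu : u ∈ l) (hv : v ∉ l) : D.dfn u < D.dfn v := by
  classical
  obtain ⟨l', hl'⟩ := hl
  simp only [dfn, ← hl', List.append_assoc]
  rw [List.idxOf_append_of_mem hu, List.idxOf_append_of_notMem hv]
  exact Nat.lt_add_right _ (List.idxOf_lt_length_iff.2 hu)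

end DFForest

namespace DFSState

variable {V : Type*} {E : V → V → Prop} {D : DFForest V}

/-- The state `s` has recorded an initial part of the forest `D`. -/
structure IsPartOf (s : DFSState V) (D : DFForest V) : Prop where
  prefix_order : s.disc <+: D.order
  parent_eq : ∀ v ∈ s.disc, D.parent v = s.parent v

theorem IsPartOf.of_step {s t : DFSState V} (ht : t.IsPartOf D) (hst : DFSStep E s t) :
    s.IsPartOf D := by
  cases hst with
  | root l par v hv =>
    exact ⟨(List.prefix_append _ _).trans ht.prefix_order,
      fun w hw => ht.parent_eq w (List.mem_append_left _ hw)⟩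
  | discover l st par par' u v huv hv hpar hpar' =>
    refine ⟨(List.prefix_append _ _).trans ht.prefix_order, fun w hw => ?_⟩
    exact (ht.parent_eq w (List.mem_append_left _ hw)).trans (hpar' w (ne_of_mem_of_not_mem hw hv))
  | finish l st par u hu => exact ⟨ht.prefix_order, ht.parent_eq⟩

/-- The invariant of a depth-first search that is about to record the forest `D`. All of its
clauses refer to ancestors and depth-first numbers in the final forest `D`, so that they do not
change when a vertex is discovered. -/
structure Invariant (E : V → V → Prop) (D : DFForest V) (s : DFSState V) : Prop where
  nodup : s.disc.Nodup
  parent_eq_none : ∀ v ∉ s.disc, s.parent v = none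
  of_parent : ∀ v ∈ s.disc, ∀ u, D.parent v = some u → E u v ∧ D.dfn u < D.dfn v
  stack_subset : s.stack ⊆ s.disc
  stack_sorted : s.stack.Pairwise fun a b => D.dfn b < D.dfn a
  parent_mem_stack : ∀ v ∈ s.stack, ∀ u, D.parent v = some u → u ∈ s.stack
  anc_of_mem_stack : ∀ a ∈ s.stack, ∀ v ∈ s.disc, D.dfn a ≤ D.dfn v → D.Anc a v
  of_finished : ∀ u ∈ s.disc, u ∉ s.stack → ∀ v, E u v →
    v ∈ s.disc ∧ ∀ a, D.Anc a u → D.dfn a ≤ D.dfn v → D.Anc a v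

theorem Invariant.empty : Invariant E D ⟨[], [], fun _ => none⟩ := by
  constructor <;> simp

theorem Invariant.mem_stack_of_anc {s : DFSState V} (hs : s.Invariant E D) {a b : V}
    (hab : D.Anc a b) (hb : b ∈ s.stack) : a ∈ s.stack := by
  induction hab using Relation.ReflTransGen.head_induction_on with
  | refl => exact hb
  | head hpar _ ih => exact hs.parent_mem_stack _ ih _ hpar

theorem Invariant.push {l st : List V} {par par' : V → Option V} {v : V}
    (hs : Invariant E D ⟨l, st, par⟩) (hl : l ++ [v] <+: D.order) (hv : v ∉ l)
    (hpar : ∀ w, w ≠ v → par' w = par w)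
    (hparent : ∀ u, D.parent v = some u → u ∈ st ∧ E u v) (hanc : ∀ a ∈ st, D.Anc a v) :
    Invariant E D ⟨l ++ [v], v :: st, par'⟩ where
  nodup := by simpa [List.nodup_append] using ⟨hs.nodup, fun w hw => ne_of_mem_of_not_mem hw hv⟩
  parent_eq_none w hw := by
    simp only [List.mem_append, List.mem_singleton, not_or] at hw
    exact (hpar w hw.2).trans (hs.parent_eq_none w hw.1)
  of_parent w hw u hu := by
    rcases List.mem_append.1 hw with hw | hw
    · exact hs.of_parent w hw u hu
    · obtain rfl := List.mem_singleton.1 hw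
      exact ⟨(hparent u hu).2,
        DFForest.dfn_lt_of_mem_of_notMem hl (hs.stack_subset (hparent u hu).1) hv⟩
  stack_subset := List.cons_subset.2
    ⟨by simp, List.Subset.trans hs.stack_subset (List.subset_append_left _ _)⟩
  stack_sorted := List.pairwise_cons.2
    ⟨fun w hw => DFForest.dfn_lt_of_mem_of_notMem hl (hs.stack_subset hw) hv, hs.stack_sorted⟩
  parent_mem_stack w hw u hu := by
    rcases List.mem_cons.1 hw with rfl | hw
    · exact List.mem_cons_of_mem _ (hparent u hu).1
    · exact List.mem_cons_of_mem _ (hs.parent_mem_stack w hw u hu)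
  anc_of_mem_stack a ha w hw hle := by
    rcases List.mem_append.1 hw with hwl | hwv
    · rcases List.mem_cons.1 ha with rfl | ha
      · exact absurd hle (DFForest.dfn_lt_of_mem_of_notMem hl hwl hv).not_ge
      · exact hs.anc_of_mem_stack a ha w hwl hle
    · obtain rfl := List.mem_singleton.1 hwv
      rcases List.mem_cons.1 ha with rfl | ha
      · exact .refl
      · exact hanc a ha
  of_finished u hu hust w huw := by
    simp only [List.mem_append, List.mem_cons, List.not_mem_nil, or_false, not_or] at hu hust
    obtain ⟨hw, h⟩ := hs.of_finished u (hu.resolve_right hust.1) hust.2 w huw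
    exact ⟨List.mem_append_left _ hw, h⟩

theorem Invariant.pop {l st : List V} {par : V → Option V} {u : V}
    (hs : Invariant E D ⟨l, u :: st, par⟩) (hu : ∀ v, E u v → v ∈ l) :
    Invariant E D ⟨l, st, par⟩ where
  nodup := hs.nodup
  parent_eq_none := hs.parent_eq_none
  of_parent := hs.of_parent
  stack_subset := (List.cons_subset.1 hs.stack_subset).2
  stack_sorted := (List.pairwise_cons.1 hs.stack_sorted).2
  parent_mem_stack v hv w hw := by
    have hvu := (List.pairwise_cons.1 hs.stack_sorted).1 v hv
    have hv' := List.mem_cons_of_mem u hv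
    rcases List.mem_cons.1 (hs.parent_mem_stack v hv' w hw) with rfl | hw'
    · exact absurd (hs.of_parent v (hs.stack_subset hv') _ hw).2 hvu.not_gt
    · exact hw'
  anc_of_mem_stack a ha := hs.anc_of_mem_stack a (List.mem_cons_of_mem _ ha)
  of_finished w hw hwst v hwv := by
    by_cases hwu : w = u
    · subst hwu
      exact ⟨hu v hwv, fun a ha =>
        hs.anc_of_mem_stack a (hs.mem_stack_of_anc ha List.mem_cons_self) v (hu v hwv)⟩
    · exact hs.of_finished w hw (List.not_mem_cons_of_ne_of_not_mem hwu hwst) v hwv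

theorem Invariant.step {s t : DFSState V} (hs : s.Invariant E D) (ht : t.IsPartOf D)
    (hst : DFSStep E s t) : t.Invariant E D := by
  cases hst with
  | root l par v hv =>
    have hroot : D.parent v = none := (ht.parent_eq v (by simp)).trans (hs.parent_eq_none v hv)
    exact hs.push ht.prefix_order hv (fun _ _ => rfl) (by simp [hroot]) (by simp)
  | discover l st par par' u v huv hv hpar hpar' =>
    have hparent : D.parent v = some u := (ht.parent_eq v (by simp)).trans hpar
    have hu : u ∈ l := hs.stack_subset List.mem_cons_self
    refine hs.push ht.prefix_order hv hpar' (fun w hw => ?_) fun a ha => ?_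
    · obtain rfl := Option.some.inj (hparent.symm.trans hw)
      exact ⟨List.mem_cons_self, huv⟩
    · refine (hs.anc_of_mem_stack a ha u hu ?_).tail hparent
      rcases List.mem_cons.1 ha with rfl | ha
      · exact le_rfl
      · exact ((List.pairwise_cons.1 hs.stack_sorted).1 a ha).le
  | finish l st par u hu => exact hs.pop hu

theorem invariant_of_run {s : DFSState V}
    (hrun : Relation.ReflTransGen (DFSStep E) ⟨[], [], fun _ => none⟩ s) (hs : s.IsPartOf D) :
    s.Invariant E D := by
  induction hrun with
  | refl => exact .empty
  | tail _ hst ih => exact (ih (hs.of_step hst)).step hs hst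

end DFSState

theorem IsDFF.isDepthFirst {V : Type*} {E : V → V → Prop} {D : DFForest V} (hD : IsDFF E D) :
    D.IsDepthFirst E := by
  obtain ⟨hrun, hmem⟩ := hD
  have hinv := DFSState.invariant_of_run hrun ⟨List.prefix_rfl, fun _ _ => rfl⟩
  exact {
    nodup := hinv.nodup
    mem_order := hmem
    edge_of_parent := fun hpar => (hinv.of_parent _ (hmem _) _ hpar).1
    dfn_lt_of_parent := fun hpar => (hinv.of_parent _ (hmem _) _ hpar).2
    anc_of_edge := fun ha huv =>
      (hinv.of_finished _ (hmem _) List.not_mem_nil _ huv).2 _ ha }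

/-! ### Loop bodies -/

namespace DFForest

variable {V : Type*} {D : DFForest V} {E : V → V → Prop}

theorem Anc.trans {a b c : V} (hab : D.Anc a b) (hbc : D.Anc b c) : D.Anc a c :=
  Relation.ReflTransGen.trans hab hbc

theorem Anc.parent {a u v : V} (ha : D.Anc a v) (hne : a ≠ v) (huv : D.parent v = some u) :
    D.Anc a u := by
  rcases Relation.ReflTransGen.cases_tail ha with rfl | ⟨c, hac, hcv⟩
  · exact absurd rfl hne
  · rwa [Option.some.inj (huv.symm.trans hcv)]

theorem Anc.total {a b v : V} (ha : D.Anc a v) (hb : D.Anc b v) : D.Anc a b ∨ D.Anc b a := by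
  induction ha with
  | refl => exact .inr hb
  | @tail u v ha huv ih =>
    by_cases hbv : b = v
    · exact hbv ▸ .inl (ha.tail huv)
    · exact ih (hb.parent hbv huv)

theorem IsDepthFirst.dfn_injective (hD : D.IsDepthFirst E) : Function.Injective D.dfn := by
  classical
  exact fun a _ hab => (List.idxOf_inj (hD.mem_order a)).1 hab

theorem IsDepthFirst.finite (hD : D.IsDepthFirst E) : Finite V :=
  Set.finite_univ_iff.1 ((List.finite_toSet D.order).subset fun v _ => hD.mem_order v)

theorem IsDepthFirst.dfn_le_of_anc (hD : D.IsDepthFirst E) {a b : V} (hab : D.Anc a b) :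
    D.dfn a ≤ D.dfn b := by
  induction hab with
  | refl => exact le_rfl
  | tail _ hpar ih => exact ih.trans (hD.dfn_lt_of_parent hpar).le

theorem IsDepthFirst.dfn_lt_of_anc (hD : D.IsDepthFirst E) {a b : V} (hab : D.Anc a b)
    (hne : a ≠ b) : D.dfn a < D.dfn b :=
  (hD.dfn_le_of_anc hab).lt_of_ne (hD.dfn_injective.ne hne)

theorem IsDepthFirst.anc_of_dfn_le (hD : D.IsDepthFirst E) {a b v : V} (ha : D.Anc a v)
    (hb : D.Anc b v) (hle : D.dfn a ≤ D.dfn b) : D.Anc a b := by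
  rcases ha.total hb with hab | hba
  · exact hab
  · rw [hD.dfn_injective (hle.antisymm (hD.dfn_le_of_anc hba))]
    exact .refl

theorem IsDepthFirst.anc_of_path (hD : D.IsDepthFirst E) {m w : V}
    (hmw : Relation.ReflTransGen (fun a b => E a b ∧ D.dfn m ≤ D.dfn a ∧ D.dfn m ≤ D.dfn b) m w) :
    D.Anc m w := by
  induction hmw with
  | refl => exact .refl
  | tail _ hbc ih => exact hD.anc_of_edge ih hbc.1 hbc.2.2

/-- `h` is the head of a loop, that is, the target of a back edge; these are the vertices for which
an exit is created. -/
def IsHead (D : DFForest V) (E : V → V → Prop) (h : V) : Prop := ∃ p, D.IsBack E p h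

/-- The loop body of `h`: the descendants of `h` that can reach `h` without leaving the subtree
of `h`. It is `{h}` if `h` is not the target of a back edge from another vertex. -/
def loopBody (D : DFForest V) (E : V → V → Prop) (h : V) : Set V :=
  {v | D.Anc h v ∧ Relation.ReflTransGen (fun a b => E a b ∧ D.Anc h a ∧ D.Anc h b) v h}

theorem mem_loopBody_self (h : V) : h ∈ D.loopBody E h := ⟨.refl, .refl⟩

theorem mem_loopBody_of_edge {h u v : V} (hv : v ∈ D.loopBody E h) (huv : E u v)
    (hu : D.Anc h u) : u ∈ D.loopBody E h :=
  ⟨hu, .head ⟨huv, hu, hv.1⟩ hv.2⟩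

theorem mem_loopBody_of_isBack {h p : V} (hp : D.IsBack E p h) : p ∈ D.loopBody E h :=
  mem_loopBody_of_edge (mem_loopBody_self h) hp.1 hp.2

theorem loopBody_subset {a b : V} (hb : b ∈ D.loopBody E a) : D.loopBody E b ⊆ D.loopBody E a :=
  fun _ hv => ⟨hb.1.trans hv.1, (Relation.ReflTransGen.mono
    (fun _ _ h => ⟨h.1, hb.1.trans h.2.1, hb.1.trans h.2.2⟩) _ _ hv.2).trans hb.2⟩

theorem IsDepthFirst.mem_loopBody_of_anc (hD : D.IsDepthFirst E) {h v w : V}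
    (hv : v ∈ D.loopBody E h) (hw : D.Anc h w) (hwv : D.Anc w v) : w ∈ D.loopBody E h := by
  induction hwv using Relation.ReflTransGen.head_induction_on with
  | refl => exact hv
  | head hpar _ ih => exact mem_loopBody_of_edge (ih (hw.tail hpar)) (hD.edge_of_parent hpar) hw

theorem IsDepthFirst.mem_loopBody_of_dfn_le (hD : D.IsDepthFirst E) {a b v : V}
    (ha : v ∈ D.loopBody E a) (hb : v ∈ D.loopBody E b) (hle : D.dfn a ≤ D.dfn b) :
    b ∈ D.loopBody E a :=
  hD.mem_loopBody_of_anc ha (hD.anc_of_dfn_le ha.1 hb.1 hle) hb.1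

theorem exists_ne_isBack_of_mem_loopBody {g u : V} (hu : u ∈ D.loopBody E g) (hne : u ≠ g) :
    ∃ p, p ≠ g ∧ D.IsBack E p g := by
  obtain ⟨-, hug⟩ := hu
  induction hug using Relation.ReflTransGen.head_induction_on with
  | refl => exact absurd rfl hne
  | @head a c hac _ ih =>
    by_cases hc : c = g
    · exact ⟨a, hne, hc ▸ hac.1, hac.2.1⟩
    · exact ih hc

theorem loopBody_eq_singleton {g : V} (hg : ¬ D.IsHead E g) : D.loopBody E g = {g} := by
  refine Set.eq_singleton_iff_unique_mem.2 ⟨mem_loopBody_self g, fun u hu => ?_⟩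
  by_contra hne
  obtain ⟨p, -, hp⟩ := exists_ne_isBack_of_mem_loopBody hu hne
  exact hg ⟨p, hp⟩

theorem isLoopedHead_iff {g : V} :
    IsLoopedHead E D g ↔ E g g ∧ ∃ u ∈ D.loopBody E g, u ≠ g := by
  refine and_congr_right fun _ => ⟨?_, ?_⟩
  · rintro ⟨p, hne, hp⟩
    exact ⟨p, mem_loopBody_of_isBack hp, hne⟩
  · rintro ⟨u, hu, hne⟩
    exact exists_ne_isBack_of_mem_loopBody hu hne

theorem IsDepthFirst.exists_mem_loopBody_of_reachable (hD : D.IsDepthFirst E) {S : Set V}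
    {u v : V} (hu : u ∈ S)
    (huv : Relation.ReflTransGen (fun a b => E a b ∧ a ∈ S ∧ b ∈ S) u v)
    (hvu : Relation.ReflTransGen (fun a b => E a b ∧ a ∈ S ∧ b ∈ S) v u) :
    ∃ m ∈ S, u ∈ D.loopBody E m ∧ v ∈ D.loopBody E m := by
  set R : V → V → Prop := fun a b => E a b ∧ a ∈ S ∧ b ∈ S
  let C : Set V := {w | Relation.ReflTransGen R u w ∧ Relation.ReflTransGen R w u}
  have hC : C.Nonempty := ⟨u, .refl, .refl⟩
  let m := Function.argminOn D.dfn C hC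
  have hm : m ∈ C := Function.argminOn_mem _ _ _
  have hmin : ∀ w ∈ C, D.dfn m ≤ D.dfn w := fun w hw => Function.argminOn_le D.dfn C hw
  have hanc : ∀ w ∈ C, D.Anc m w := fun w hw =>
    hD.anc_of_path <| Relation.ReflTransGen.mono (fun _ _ h => ⟨h.1.1, h.2⟩) _ _ <|
      reflTransGen_and_of_between (hm.2.trans hw.1) fun c hmc hcw =>
        hmin c ⟨hm.1.trans hmc, hcw.trans hw.2⟩
  have hbody : ∀ w ∈ C, w ∈ D.loopBody E m := fun w hw =>
    ⟨hanc w hw, Relation.ReflTransGen.mono (fun _ _ h => ⟨h.1.1, h.2⟩) _ _ <|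
      reflTransGen_and_of_between (hw.2.trans hm.1) fun c hwc hcm =>
        hanc c ⟨hw.1.trans hwc, hcm.trans hm.2⟩⟩
  have hmS : m ∈ S := by
    rcases Relation.ReflTransGen.cases_tail hm.1 with h | ⟨c, _, hcm⟩
    · rwa [h]
    · exact hcm.2.2
  exact ⟨m, hmS, hbody u ⟨.refl, .refl⟩, hbody v ⟨huv, hvu⟩⟩

theorem IsDepthFirst.reachable_of_mem_loopBody (hD : D.IsDepthFirst E) {h u v : V}
    (hu : u ∈ D.loopBody E h) (hv : v ∈ D.loopBody E h) :
    Relation.ReflTransGen (fun a b => E a b ∧ a ∈ D.loopBody E h ∧ b ∈ D.loopBody E h) u v := by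
  have hback : ∀ {a b}, Relation.ReflTransGen (fun x y => E x y ∧ D.Anc h x ∧ D.Anc h y) a b →
      D.Anc h a → D.Anc h b := by
    intro a b hab ha
    rcases Relation.ReflTransGen.cases_tail hab with rfl | ⟨c, _, hcb⟩
    · exact ha
    · exact hcb.2.2
  have huh := reflTransGen_and_of_between (P := (· ∈ D.loopBody E h)) hu.2 fun c huc hch =>
    ⟨hback huc hu.1, hch⟩
  have hhv := reflTransGen_and_of_between (P := (· ∈ D.loopBody E h)) hv.1 fun c hhc hcv =>
    hD.mem_loopBody_of_anc hv hhc hcv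
  exact (Relation.ReflTransGen.mono (fun _ _ h => ⟨h.1.1, h.2⟩) _ _ huh).trans
    (Relation.ReflTransGen.mono (fun _ _ h => ⟨hD.edge_of_parent h.1, h.2⟩) _ _ hhv)

end DFForest

/-! ### Representatives -/

namespace DFForest

variable {V : Type*} {D : DFForest V} {E : V → V → Prop}

/-- The vertices with depth-first number at least `k` whose loop body contains `v`, together with
`v` itself. They form a chain of the forest, so that they are determined by their depth-first
numbers. -/
def enclosingHeads (D : DFForest V) (E : V → V → Prop) (k : ℕ) (v : V) : Set V :=
  {r | v ∈ D.loopBody E r ∧ (r = v ∨ k ≤ D.dfn r)}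

theorem enclosingHeads_nonempty (D : DFForest V) (E : V → V → Prop) (k : ℕ) (v : V) :
    (D.enclosingHeads E k v).Nonempty :=
  ⟨v, mem_loopBody_self v, .inl rfl⟩

/-- The outermost head `r` with depth-first number at least `k` whose loop body contains `v`, or
`v` itself: the representative of `v` in the bottom-up algorithm when the vertices with depth-first
number at least `k` have been processed. -/
noncomputable def repAt (D : DFForest V) (E : V → V → Prop) (k : ℕ) (v : V) : V :=
  Function.argminOn D.dfn (D.enclosingHeads E k v) (D.enclosingHeads_nonempty E k v)

theorem repAt_mem_enclosingHeads (k : ℕ) (v : V) : D.repAt E k v ∈ D.enclosingHeads E k v :=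
  Function.argminOn_mem _ _ _

theorem mem_loopBody_repAt (k : ℕ) (v : V) : v ∈ D.loopBody E (D.repAt E k v) :=
  (repAt_mem_enclosingHeads k v).1

theorem dfn_repAt_le {k : ℕ} {v g : V} (hg : g ∈ D.enclosingHeads E k v) :
    D.dfn (D.repAt E k v) ≤ D.dfn g :=
  Function.argminOn_le D.dfn _ hg

theorem le_dfn_repAt {k : ℕ} {v : V} (hv : k ≤ D.dfn v) : k ≤ D.dfn (D.repAt E k v) := by
  rcases (repAt_mem_enclosingHeads (D := D) (E := E) k v).2 with h | h
  · rwa [h]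
  · exact h

theorem IsDepthFirst.repAt_eq (hD : D.IsDepthFirst E) {k : ℕ} {v r : V}
    (hr : r ∈ D.enclosingHeads E k v)
    (hmin : ∀ g ∈ D.enclosingHeads E k v, D.dfn r ≤ D.dfn g) : D.repAt E k v = r :=
  hD.dfn_injective ((dfn_repAt_le hr).antisymm (hmin _ (repAt_mem_enclosingHeads k v)))

theorem IsDepthFirst.repAt_eq_repAt (hD : D.IsDepthFirst E) {k : ℕ} {v w : V}
    (hw : w ∈ D.enclosingHeads E k v) : D.repAt E k v = D.repAt E k w := by
  obtain ⟨hv, rfl | hk⟩ := hw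
  · rfl
  refine hD.repAt_eq ⟨loopBody_subset (mem_loopBody_repAt k w) hv, .inr (le_dfn_repAt hk)⟩ ?_
  rintro g ⟨hg, hgk⟩
  rcases le_or_gt (D.dfn w) (D.dfn g) with hle | hlt
  · exact (dfn_repAt_le ⟨mem_loopBody_self w, .inl rfl⟩).trans hle
  · refine dfn_repAt_le ⟨hD.mem_loopBody_of_dfn_le hg hv hlt.le, ?_⟩
    rcases hgk with rfl | hgk
    · exact absurd (hD.dfn_le_of_anc hv.1) hlt.not_ge
    · exact .inr hgk

theorem IsDepthFirst.repAt_repAt (hD : D.IsDepthFirst E) (k : ℕ) (v : V) :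
    D.repAt E k (D.repAt E k v) = D.repAt E k v :=
  (hD.repAt_eq_repAt (repAt_mem_enclosingHeads k v)).symm

theorem IsDepthFirst.repAt_eq_of_le (hD : D.IsDepthFirst E) {k j : ℕ} {v : V} (hkj : k ≤ j)
    (hj : D.repAt E k v ∈ D.enclosingHeads E j v) : D.repAt E j v = D.repAt E k v :=
  hD.repAt_eq hj fun _ hg => dfn_repAt_le ⟨hg.1, hg.2.imp_right hkj.trans⟩

theorem IsDepthFirst.repAt_of_dfn_lt (hD : D.IsDepthFirst E) {k : ℕ} {v : V} (hv : D.dfn v < k) :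
    D.repAt E k v = v := by
  obtain ⟨hbody, h | h⟩ := repAt_mem_enclosingHeads (D := D) (E := E) k v
  · exact h
  · exact absurd (h.trans (hD.dfn_le_of_anc hbody.1)) hv.not_ge

theorem IsDepthFirst.repAt_succ_self (hD : D.IsDepthFirst E) (h : V) :
    D.repAt E (D.dfn h + 1) h = h :=
  hD.repAt_of_dfn_lt (Nat.lt_succ_self _)

theorem IsDepthFirst.repAt_dfn (hD : D.IsDepthFirst E) {h v : V} (hv : v ∈ D.loopBody E h) :
    D.repAt E (D.dfn h) v = h := by
  refine hD.repAt_eq ⟨hv, .inr le_rfl⟩ ?_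
  rintro g ⟨-, rfl | hg⟩
  · exact hD.dfn_le_of_anc hv.1
  · exact hg

theorem IsDepthFirst.repAt_dfn_of_notMem (hD : D.IsDepthFirst E) {h v : V}
    (hv : v ∉ D.loopBody E h) : D.repAt E (D.dfn h) v = D.repAt E (D.dfn h + 1) v := by
  obtain ⟨hbody, hk⟩ := repAt_mem_enclosingHeads (D := D) (E := E) (D.dfn h) v
  refine (hD.repAt_eq_of_le (Nat.le_succ _) ⟨hbody, hk.imp_right fun hle => ?_⟩).symm
  refine hle.lt_of_ne fun he => hv ?_
  rwa [hD.dfn_injective he]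

theorem IsDepthFirst.mem_loopBody_repAt_iff (hD : D.IsDepthFirst E) {k : ℕ} {u v : V}
    (hk : k ≤ D.dfn v) :
    u ∈ D.loopBody E (D.repAt E k v) ↔ D.repAt E k u = D.repAt E k v := by
  constructor
  · intro h
    rw [hD.repAt_eq_repAt ⟨h, .inr (le_dfn_repAt hk)⟩, hD.repAt_repAt]
  · intro h
    rw [← h]
    exact mem_loopBody_repAt k u

theorem IsDepthFirst.repAt_eq_of_edge (hD : D.IsDepthFirst E) {k : ℕ} {u v : V} (huv : E u v)
    (hu : D.Anc (D.repAt E k v) u) (hk : k ≤ D.dfn v) : D.repAt E k u = D.repAt E k v :=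
  (hD.mem_loopBody_repAt_iff hk).1 (mem_loopBody_of_edge (mem_loopBody_repAt k v) huv hu)

theorem IsDepthFirst.repAt_mem_loopBody_diff (hD : D.IsDepthFirst E) {h v : V}
    (hv : v ∈ D.loopBody E h \ {h}) :
    D.repAt E (D.dfn h + 1) v ∈ D.loopBody E h \ {h} := by
  have hlt : D.dfn h < D.dfn (D.repAt E (D.dfn h + 1) v) :=
    le_dfn_repAt (hD.dfn_lt_of_anc hv.1.1 (Ne.symm hv.2))
  exact ⟨hD.mem_loopBody_of_dfn_le hv.1 (mem_loopBody_repAt _ _) hlt.le,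
    fun he => hlt.ne (congrArg D.dfn he).symm⟩

theorem IsDepthFirst.repAt_eq_of_reachable (hD : D.IsDepthFirst E) {k : ℕ} {S : Set V}
    (hS : ∀ v ∈ S, k ≤ D.dfn v) {u v : V} (hu : u ∈ S)
    (huv : Relation.ReflTransGen (fun a b => E a b ∧ a ∈ S ∧ b ∈ S) u v)
    (hvu : Relation.ReflTransGen (fun a b => E a b ∧ a ∈ S ∧ b ∈ S) v u) :
    D.repAt E k u = D.repAt E k v := by
  obtain ⟨m, hmS, hum, hvm⟩ := hD.exists_mem_loopBody_of_reachable hu huv hvu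
  exact (hD.repAt_eq_repAt ⟨hum, .inr (hS m hmS)⟩).trans
    (hD.repAt_eq_repAt ⟨hvm, .inr (hS m hmS)⟩).symm

end DFForest

/-! ### The closed forms of the outputs -/

namespace DFForest

variable {V : Type*} {D : DFForest V} {E : V → V → Prop}

open Classical in
/-- The exit of the component with head `r`. -/
noncomputable def headExit (D : DFForest V) (E : V → V → Prop) (r : V) : Node V :=
  if D.IsHead E r then Node.exit r else Node.vtx r

open Classical in
/-- The map `exit` of the bottom-up algorithm when the vertices with depth-first number at least `k`
have been processed. -/
noncomputable def exitAt (D : DFForest V) (E : V → V → Prop) (k : ℕ) (r : V) : Node V :=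
  if k ≤ D.dfn r then D.headExit E r else Node.vtx r

/-- The exit of the component that contains `u` when the heads with depth-first number at least `k`
have been processed: `exit[rep(u)]` in the bottom-up algorithm. -/
noncomputable def repExit (D : DFForest V) (E : V → V → Prop) (k : ℕ) (u : V) : Node V :=
  D.exitAt E k (D.repAt E k u)

theorem headExit_ne_vtx {r g : V} (hne : r ≠ g) : D.headExit E r ≠ Node.vtx g := by
  unfold headExit
  split_ifs <;> simp [hne]

theorem repExit_of_le {k : ℕ} {u : V} (hu : k ≤ D.dfn u) :
    D.repExit E k u = D.headExit E (D.repAt E k u) :=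
  if_pos (le_dfn_repAt hu)

theorem IsDepthFirst.repExit_succ_self (hD : D.IsDepthFirst E) (g : V) :
    D.repExit E (D.dfn g + 1) g = Node.vtx g := by
  rw [repExit, hD.repAt_succ_self, exitAt, if_neg (Nat.lt_succ_self _).not_ge]

theorem IsDepthFirst.repExit_ne_vtx (hD : D.IsDepthFirst E) {g u : V}
    (hu : u ∈ D.loopBody E g \ {g}) : D.repExit E (D.dfn g + 1) u ≠ Node.vtx g := by
  rw [repExit_of_le (hD.dfn_lt_of_anc hu.1.1 (Ne.symm hu.2))]
  exact headExit_ne_vtx (hD.repAt_mem_loopBody_diff hu).2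

/-- The exits created for the heads in `S`. -/
def headExits (D : DFForest V) (E : V → V → Prop) (S : Set V) : Set (Node V) :=
  {a | ∃ g ∈ S, D.IsHead E g ∧ a = Node.exit g}

/-- The stabilization constraints for the heads in `S`. -/
def headStab (D : DFForest V) (E : V → V → Prop) (S : Set V) (a b : Node V) : Prop :=
  ∃ g ∈ S, D.IsHead E g ∧ a = Node.exit g ∧ b = Node.vtx g

theorem mem_headExits_insert_iff {g : V} {S : Set V} {a : Node V} :
    a ∈ D.headExits E (insert g S) ↔ a ∈ D.headExits E S ∨ D.IsHead E g ∧ a = Node.exit g := by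
  rw [or_comm]
  exact Set.exists_mem_insert

theorem headStab_insert_iff {g : V} {S : Set V} {a b : Node V} :
    D.headStab E (insert g S) a b ↔
      D.headStab E S a b ∨ D.IsHead E g ∧ a = Node.exit g ∧ b = Node.vtx g := by
  rw [or_comm]
  exact Set.exists_mem_insert

/-- The scheduling constraints for the edges from `S` to `T` that connect different components when
the heads with depth-first number at least `k` have been processed. -/
def crossSched (D : DFForest V) (E : V → V → Prop) (k : ℕ) (S T : Set V) (a b : Node V) : Prop :=
  ∃ u ∈ S, ∃ v ∈ T, E u v ∧ D.repAt E k u ≠ D.repAt E k v ∧ a = D.repExit E k u ∧ b = Node.vtx v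

/-- The scheduling constraints into the exit of `g` for the edges from `S` to `g`. -/
def backSched (D : DFForest V) (E : V → V → Prop) (g : V) (S : Set V) (a b : Node V) : Prop :=
  ∃ u ∈ S, E u g ∧ a = D.repExit E (D.dfn g + 1) u ∧ b = Node.exit g

/-- The scheduling constraints that the bottom-up algorithm adds for the head `g`. -/
def headSched (D : DFForest V) (E : V → V → Prop) (g : V) (a b : Node V) : Prop :=
  D.crossSched E (D.dfn g + 1) (D.loopBody E g) (D.loopBody E g \ {g}) a b ∨
    D.backSched E g (D.loopBody E g) a b

/-- The scheduling constraints that the top-down algorithm adds for the head `g`: a self-loop at the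
head of a larger component is treated as one of the edges out of `g`, not as a back edge. -/
def headSchedTD (D : DFForest V) (E : V → V → Prop) (g : V) (a b : Node V) : Prop :=
  (D.headSched E g a b ∧ ¬ (IsLoopedHead E D g ∧ a = Node.vtx g ∧ b = Node.exit g)) ∨
    (IsLoopedHead E D g ∧ a = Node.vtx g ∧ b = Node.vtx g)

/-- The 4-tuple in which the head `g` contributes the scheduling constraints `c g`; the remaining
ones connect the maximal strongly connected components. -/
def closedWPO (D : DFForest V) (E : V → V → Prop) (c : V → Node V → Node V → Prop) :
    WPOTuple V where
  verts := Set.range Node.vtx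
  exits := D.headExits E Set.univ
  sched a b := (∃ g, c g a b) ∨ D.crossSched E 0 Set.univ Set.univ a b
  stab := D.headStab E Set.univ

theorem headSchedTD_iff_headSched {g : V} {a b : Node V}
    (h : ¬ (IsLoopedHead E D g ∧ a = Node.vtx g ∧ (b = Node.vtx g ∨ b = Node.exit g))) :
    D.headSchedTD E g a b ↔ D.headSched E g a b := by
  constructor
  · rintro (⟨hs, -⟩ | ⟨hl, ha, hb⟩)
    · exact hs
    · exact absurd ⟨hl, ha, .inl hb⟩ h
  · exact fun hs => .inl ⟨hs, fun ⟨hl, ha, hb⟩ => h ⟨hl, ha, .inr hb⟩⟩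

theorem insert_loopBody_diff (g : V) :
    insert g (D.loopBody E g \ {g}) = D.loopBody E g :=
  Set.insert_sdiff_self_of_mem (mem_loopBody_self g)

theorem IsDepthFirst.crossSched_loopBody_iff (hD : D.IsDepthFirst E) {g : V} {a b : Node V} :
    D.crossSched E (D.dfn g + 1) (D.loopBody E g) (D.loopBody E g \ {g}) a b ↔
      a = Node.vtx g ∧ (∃ v ∈ D.loopBody E g \ {g}, E g v ∧ b = Node.vtx v) ∨
      D.crossSched E (D.dfn g + 1) (D.loopBody E g \ {g}) (D.loopBody E g \ {g}) a b := by
  nth_rw 1 [crossSched, ← insert_loopBody_diff g]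
  rw [Set.exists_mem_insert, hD.repAt_succ_self, hD.repExit_succ_self]
  refine or_congr_left ⟨?_, ?_⟩
  · rintro ⟨v, hv, hgv, -, ha, hb⟩
    exact ⟨ha, v, hv, hgv, hb⟩
  · rintro ⟨ha, v, hv, hgv, hb⟩
    exact ⟨v, hv, hgv, Ne.symm (hD.repAt_mem_loopBody_diff hv).2, ha, hb⟩

theorem IsDepthFirst.backSched_loopBody_iff (hD : D.IsDepthFirst E) {g : V} {a b : Node V} :
    D.backSched E g (D.loopBody E g) a b ↔
      (E g g ∧ a = Node.vtx g ∧ b = Node.exit g) ∨ D.backSched E g (D.loopBody E g \ {g}) a b := by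
  nth_rw 1 [backSched, ← insert_loopBody_diff g]
  rw [Set.exists_mem_insert, hD.repExit_succ_self]
  rfl

theorem IsDepthFirst.headSchedTD_iff (hD : D.IsDepthFirst E) {g : V}
    (hg : ∃ u ∈ D.loopBody E g, u ≠ g) {a b : Node V} :
    D.headSchedTD E g a b ↔
      D.crossSched E (D.dfn g + 1) (D.loopBody E g \ {g}) (D.loopBody E g \ {g}) a b ∨
      D.backSched E g (D.loopBody E g \ {g}) a b ∨
      a = Node.vtx g ∧ ∃ v ∈ D.loopBody E g, E g v ∧ b = Node.vtx v := by
  have hlooped : IsLoopedHead E D g ↔ E g g := by rw [isLoopedHead_iff, and_iff_left hg]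
  have hcross : D.crossSched E (D.dfn g + 1) (D.loopBody E g \ {g}) (D.loopBody E g \ {g}) a b →
      a ≠ Node.vtx g := by
    rintro ⟨u, hu, _, _, _, _, rfl, _⟩
    exact hD.repExit_ne_vtx hu
  have hback : D.backSched E g (D.loopBody E g \ {g}) a b → a ≠ Node.vtx g := by
    rintro ⟨u, hu, _, rfl, _⟩
    exact hD.repExit_ne_vtx hu
  have hout : (∃ v ∈ D.loopBody E g, E g v ∧ b = Node.vtx v) ↔
      (E g g ∧ b = Node.vtx g) ∨ ∃ v ∈ D.loopBody E g \ {g}, E g v ∧ b = Node.vtx v := by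
    nth_rw 1 [← insert_loopBody_diff g]
    exact Set.exists_mem_insert
  rw [headSchedTD, headSched, hD.crossSched_loopBody_iff, hD.backSched_loopBody_iff, hlooped, hout]
  grind

theorem IsDepthFirst.headSchedTD_iff_of_loopBody_eq (hD : D.IsDepthFirst E) {g : V}
    (hg : D.loopBody E g = {g}) {a b : Node V} :
    D.headSchedTD E g a b ↔ E g g ∧ a = Node.vtx g ∧ b = Node.exit g := by
  have hlooped : ¬ IsLoopedHead E D g := by simp [isLoopedHead_iff, hg]
  rw [headSchedTD_iff_headSched fun h => hlooped h.1, headSched, hD.crossSched_loopBody_iff,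
    hD.backSched_loopBody_iff]
  simp [hg, crossSched, backSched]

end DFForest

/-! ### The top-down construction -/

namespace NGraph

variable {V : Type*} {G : NGraph V}

/-- The strongly connected component of a vertex. -/
def scc (G : NGraph V) (a : Node V) : Set (Node V) :=
  {b ∈ G.verts | Relation.ReflTransGen G.edge a b ∧ Relation.ReflTransGen G.edge b a}

theorem isMaxSCC_scc {a : Node V} (ha : a ∈ G.verts) : G.IsMaxSCC (G.scc a) := by
  have hself : a ∈ G.scc a := ⟨ha, .refl, .refl⟩
  refine ⟨⟨fun b hb => hb.1, ⟨a, hself⟩, fun u hu v hv => hu.2.2.trans hv.2.1⟩, ?_⟩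
  exact fun C hC hle b hb => ⟨hC.1 hb, hC.2.2 a (hle hself) b hb, hC.2.2 b hb a (hle hself)⟩

theorem IsMaxSCC.eq_scc {C : Set (Node V)} (hC : G.IsMaxSCC C) {a : Node V} (ha : a ∈ C) :
    C = G.scc a :=
  hC.eq_of_subset (isMaxSCC_scc (hC.1.1 ha)).1 fun b hb =>
    ⟨hC.1.1 hb, hC.1.2.2 a ha b hb, hC.1.2.2 b hb a ha⟩

theorem exists_isMaxSCC_preimage_iff {ι : Type*} (f : ι → Node V) {q : ι → Prop} :
    (∃ C : {C // G.IsMaxSCC C}, ∃ i ∈ f ⁻¹' C.1, q i) ↔ ∃ i ∈ f ⁻¹' G.verts, q i := by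
  constructor
  · rintro ⟨C, i, hi, hq⟩
    exact ⟨i, C.2.1.1 hi, hq⟩
  · rintro ⟨i, hi, hq⟩
    exact ⟨⟨_, isMaxSCC_scc hi⟩, i, ⟨hi, .refl, .refl⟩, hq⟩

/-- The scheduling constraints for the edges between different strongly connected components of `G`,
where `e u` is the exit of the component of `u`. -/
def crossing (G : NGraph V) (e : Node V → Node V) (a b : Node V) : Prop :=
  ∃ u ∈ G.verts, G.edge u b ∧ b ∈ G.verts \ G.scc u ∧ a = e u

theorem crossing_iff_exists_isMaxSCC {e : Node V → Node V}
    {r : {C // G.IsMaxSCC C} → SCCResult V} (hr : ∀ C, ∀ u ∈ C.1, (r C).exit = e u)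
    {a b : Node V} :
    (∃ C C' u, C ≠ C' ∧ G.edge u b ∧ u ∈ C.1 ∧ b ∈ C'.1 ∧ a = (r C).exit) ↔
      G.crossing e a b := by
  constructor
  · rintro ⟨C, C', u, hne, hub, hu, hb, rfl⟩
    refine ⟨u, C.2.1.1 hu, hub, ⟨C'.2.1.1 hb, fun hbu => hne (Subtype.ext ?_)⟩, hr C u hu⟩
    rw [← C.2.eq_scc hu] at hbu
    rw [C.2.eq_scc hbu, C'.2.eq_scc hb]
  · rintro ⟨u, hu, hub, ⟨hb, hbu⟩, rfl⟩
    have huu : u ∈ G.scc u := ⟨hu, .refl, .refl⟩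
    have hbb : b ∈ G.scc b := ⟨hb, .refl, .refl⟩
    refine ⟨⟨_, isMaxSCC_scc hu⟩, ⟨_, isMaxSCC_scc hb⟩, u, fun h => hbu ?_, hub, huu, hbb,
      (hr ⟨_, isMaxSCC_scc hu⟩ u huu).symm⟩
    have hscc : G.scc u = G.scc b := congrArg Subtype.val h
    rwa [hscc]

end NGraph

namespace DFForest

variable {V : Type*} {D : DFForest V} {E : V → V → Prop}

/-- The contribution of the loop heads in `C` to the 4-tuple of the top-down algorithm. -/
def innerWPO (D : DFForest V) (E : V → V → Prop) (C : Set (Node V)) : WPOTuple V where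
  verts := C
  exits := D.headExits E (Node.vtx ⁻¹' C)
  sched a b := ∃ g ∈ Node.vtx ⁻¹' C, D.headSchedTD E g a b
  stab := D.headStab E (Node.vtx ⁻¹' C)

/-- The union of the 4-tuples `innerWPO` of the strongly connected components of `G`, which are
connected through the exits given by `e`. -/
def joinWPO (D : DFForest V) (E : V → V → Prop) (e : Node V → Node V) (G : NGraph V) :
    WPOTuple V :=
  { D.innerWPO E G.verts with
    sched := fun a b => (D.innerWPO E G.verts).sched a b ∨ G.crossing e a b }

theorem connectTD_eq_joinWPO {G : NGraph V} {e : Node V → Node V}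
    {r : {C // G.IsMaxSCC C} → SCCResult V} (hwpo : ∀ C, (r C).wpo = D.innerWPO E C.1)
    (hexit : ∀ C, ∀ u ∈ C.1, (r C).exit = e u) : connectTD G r = D.joinWPO E e G := by
  simp only [connectTD, hwpo, NGraph.crossing_iff_exists_isMaxSCC hexit, joinWPO, innerWPO]
  congr 1
  · ext a
    simpa using G.exists_isMaxSCC_preimage_iff id (q := (a = ·))
  · ext a
    exact NGraph.exists_isMaxSCC_preimage_iff Node.vtx
  · funext a b
    rw [NGraph.exists_isMaxSCC_preimage_iff Node.vtx]
  · funext a b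
    exact propext (NGraph.exists_isMaxSCC_preimage_iff Node.vtx)

/-- The graph `(V, E)` induced on the loop body of `h`. -/
def bodyGraph (D : DFForest V) (E : V → V → Prop) (h : V) : NGraph V where
  verts := Node.vtx '' D.loopBody E h
  edge a b := ∃ u ∈ D.loopBody E h, ∃ v ∈ D.loopBody E h,
    E u v ∧ a = Node.vtx u ∧ b = Node.vtx v

theorem vtx_mem_verts_bodyGraph (h : V) : Node.vtx h ∈ (D.bodyGraph E h).verts :=
  ⟨h, mem_loopBody_self h, rfl⟩

theorem preimage_vtx_image (S : Set V) : Node.vtx ⁻¹' (Node.vtx '' S) = S :=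
  Set.preimage_image_eq S fun _ _ => Node.vtx.inj

theorem preimage_vtx_verts_breakHead (h : V) :
    Node.vtx ⁻¹' ((D.bodyGraph E h).breakHead h).verts = D.loopBody E h \ {h} := by
  ext v
  simp [NGraph.breakHead, bodyGraph]

theorem edge_breakHead_bodyGraph_vtx {h v : V} {a : Node V} :
    ((D.bodyGraph E h).breakHead h).edge a (Node.vtx v) ↔
      ∃ u ∈ D.loopBody E h \ {h}, v ∈ D.loopBody E h \ {h} ∧ E u v ∧ a = Node.vtx u := by
  simp only [NGraph.breakHead, bodyGraph]
  cases a with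
  | vtx u => simp; tauto
  | exit y => simp

theorem edge_breakHead_bodyGraph_exit {h x : V} {a : Node V} :
    ((D.bodyGraph E h).breakHead h).edge a (Node.exit x) ↔
      ∃ u ∈ D.loopBody E h, E u h ∧ a = Node.vtx u ∧ x = h := by
  have := mem_loopBody_self (D := D) (E := E) h
  simp only [NGraph.breakHead, bodyGraph]
  cases a with
  | vtx u => simp; tauto
  | exit y => simp

/-- `G` is one of the graphs of the top-down recursion: the subgraph of `(V, E)` induced on a union
of loop bodies with heads of depth-first number at least `k`, extended by exits without outgoing
edges. -/
structure IsLevel (D : DFForest V) (E : V → V → Prop) (G : NGraph V) (k : ℕ) : Prop where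
  edge_vtx : ∀ u v, G.edge (Node.vtx u) (Node.vtx v) ↔
    E u v ∧ Node.vtx u ∈ G.verts ∧ Node.vtx v ∈ G.verts
  not_edge_exit : ∀ x b, ¬ G.edge (Node.exit x) b
  le_dfn : ∀ v, Node.vtx v ∈ G.verts → k ≤ D.dfn v
  loopBody_subset : ∀ v, Node.vtx v ∈ G.verts →
    Node.vtx '' D.loopBody E (D.repAt E k v) ⊆ G.verts

theorem isLevel_ofRel : D.IsLevel E (NGraph.ofRel E) 0 := by
  constructor <;> simp [NGraph.ofRel]

theorem IsDepthFirst.isLevel_breakHead (hD : D.IsDepthFirst E) (h : V) :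
    D.IsLevel E ((D.bodyGraph E h).breakHead h) (D.dfn h + 1) := by
  have hmem : ∀ v, Node.vtx v ∈ ((D.bodyGraph E h).breakHead h).verts ↔
      v ∈ D.loopBody E h \ {h} := Set.ext_iff.1 (preimage_vtx_verts_breakHead h)
  have hlt : ∀ v ∈ D.loopBody E h \ {h}, D.dfn h < D.dfn v := fun v hv =>
    hD.dfn_lt_of_anc hv.1.1 (Ne.symm hv.2)
  refine ⟨fun u v => ?_, fun x b => ?_, fun v hv => hlt v ((hmem v).1 hv), ?_⟩
  · rw [hmem, hmem, edge_breakHead_bodyGraph_vtx]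
    constructor
    · rintro ⟨_, hu, hv, huv, ⟨⟩⟩
      exact ⟨huv, hu, hv⟩
    · rintro ⟨huv, hu, hv⟩
      exact ⟨u, hu, hv, huv, rfl⟩
  · cases b with
    | vtx v => simp [edge_breakHead_bodyGraph_vtx]
    | exit y => simp [edge_breakHead_bodyGraph_exit]
  · rintro v hv _ ⟨w, hw, rfl⟩
    have hv := (hmem v).1 hv
    refine (hmem w).2 ⟨DFForest.loopBody_subset (hD.repAt_mem_loopBody_diff hv).1 hw, ?_⟩
    rintro rfl
    exact (le_dfn_repAt (hlt v hv)).not_gt (Nat.lt_succ_of_le (hD.dfn_le_of_anc hw.1))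

namespace IsLevel

variable {G : NGraph V} {k : ℕ}

theorem reachable_of_path (hG : D.IsLevel E G k) {u v : V}
    (huv : Relation.ReflTransGen G.edge (Node.vtx u) (Node.vtx v)) :
    Relation.ReflTransGen
      (fun a b => E a b ∧ a ∈ Node.vtx ⁻¹' G.verts ∧ b ∈ Node.vtx ⁻¹' G.verts) u v := by
  generalize hb : Node.vtx v = b at huv
  induction huv generalizing v with
  | refl =>
    obtain rfl := Node.vtx.inj hb
    exact .refl
  | @tail b c _ hbc ih =>
    subst hb
    cases b with
    | vtx w => exact (ih rfl).tail ((hG.edge_vtx w v).1 hbc)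
    | exit x => exact absurd hbc (hG.not_edge_exit x _)

theorem path_of_mem_loopBody (hG : D.IsLevel E G k) (hD : D.IsDepthFirst E) {r u v : V}
    (hr : Node.vtx '' D.loopBody E r ⊆ G.verts) (hu : u ∈ D.loopBody E r)
    (hv : v ∈ D.loopBody E r) : Relation.ReflTransGen G.edge (Node.vtx u) (Node.vtx v) :=
  (hD.reachable_of_mem_loopBody hu hv).lift Node.vtx fun a b hab =>
    (hG.edge_vtx a b).2 ⟨hab.1, hr ⟨a, hab.2.1, rfl⟩, hr ⟨b, hab.2.2, rfl⟩⟩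

theorem scc_exit (hG : D.IsLevel E G k) {x : V} (hx : Node.exit x ∈ G.verts) :
    G.scc (Node.exit x) = {Node.exit x} := by
  refine Set.eq_singleton_iff_unique_mem.2 ⟨⟨hx, .refl, .refl⟩, fun a ha => ?_⟩
  rcases ha.2.1.cases_head with h | ⟨c, hc, _⟩
  · exact h.symm
  · exact absurd hc (hG.not_edge_exit x c)

theorem scc_vtx (hG : D.IsLevel E G k) (hD : D.IsDepthFirst E) {v : V}
    (hv : Node.vtx v ∈ G.verts) :
    G.scc (Node.vtx v) = Node.vtx '' D.loopBody E (D.repAt E k v) := by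
  have hsub := hG.loopBody_subset v hv
  refine Set.Subset.antisymm ?_ ?_
  · rintro (w | x) ⟨ha, hva, hav⟩
    · exact ⟨w, (hD.mem_loopBody_repAt_iff (hG.le_dfn v hv)).2 (hD.repAt_eq_of_reachable hG.le_dfn
        ha (hG.reachable_of_path hav) (hG.reachable_of_path hva)), rfl⟩
    · have hvx : Node.vtx v ∈ G.scc (Node.exit x) := ⟨hv, hav, hva⟩
      rw [hG.scc_exit ha] at hvx
      cases hvx
  · rintro _ ⟨w, hw, rfl⟩
    have hvr := mem_loopBody_repAt (D := D) (E := E) k v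
    exact ⟨hsub ⟨w, hw, rfl⟩, hG.path_of_mem_loopBody hD hsub hvr hw,
      hG.path_of_mem_loopBody hD hsub hw hvr⟩

theorem restrict_loopBody (hG : D.IsLevel E G k) {r : V}
    (hr : Node.vtx '' D.loopBody E r ⊆ G.verts) :
    G.restrict (Node.vtx '' D.loopBody E r) = D.bodyGraph E r := by
  rw [NGraph.restrict, bodyGraph, Set.inter_eq_right.2 hr]
  congr 1
  funext a b
  refine propext ⟨?_, ?_⟩
  · rintro ⟨hab, ⟨u, hu, rfl⟩, v, hv, rfl⟩
    exact ⟨u, hu, v, hv, ((hG.edge_vtx u v).1 hab).1, rfl, rfl⟩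
  · rintro ⟨u, hu, v, hv, huv, rfl, rfl⟩
    exact ⟨(hG.edge_vtx u v).2 ⟨huv, hr ⟨u, hu, rfl⟩, hr ⟨v, hv, rfl⟩⟩, ⟨u, hu, rfl⟩, v, hv, rfl⟩

end IsLevel

end DFForest

/-! ### The result of the top-down algorithm -/

section SccWPO

variable {V : Type*} [Finite V] {D : DFForest V} {G : NGraph V}

theorem sccWPO_of_minDFN_eq_exit (hG : G.verts.Nonempty) {x : V}
    (hx : G.minDFN D hG = Node.exit x) : sccWPO D G hG = trivialWPO (Node.exit x) := by
  rw [sccWPO]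
  split <;> simp_all

open Classical in
theorem sccWPO_of_minDFN_eq_vtx (hG : G.verts.Nonempty) {h : V}
    (hh : G.minDFN D hG = Node.vtx h) : sccWPO D G hG =
      if ¬ ∃ v ∈ G.verts, G.edge v (Node.vtx h) then trivialWPO (Node.vtx h)
      else if G.verts.ncard = 1 then selfLoopWPO h
      else extendTD G h (constructTD D (G.breakHead h)) := by
  rw [sccWPO]
  split <;> simp_all

theorem sccWPO_congr {G' : NGraph V} (h : G = G') (hG : G.verts.Nonempty)
    (hG' : G'.verts.Nonempty) : sccWPO D G hG = sccWPO D G' hG' := by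
  subst h
  rfl

end SccWPO

namespace DFForest

variable {V : Type*} {D : DFForest V} {E : V → V → Prop}

theorem verts_bodyGraph_nonempty (h : V) : (D.bodyGraph E h).verts.Nonempty :=
  ⟨_, vtx_mem_verts_bodyGraph h⟩

theorem IsDepthFirst.minDFN_bodyGraph [Finite V] (hD : D.IsDepthFirst E) (h : V) :
    (D.bodyGraph E h).minDFN D (verts_bodyGraph_nonempty h) = Node.vtx h := by
  obtain ⟨v, hv, hmin⟩ := (D.bodyGraph E h).minDFN_mem D (verts_bodyGraph_nonempty h)
  have hle : D.nodeDFN ((D.bodyGraph E h).minDFN D (verts_bodyGraph_nonempty h)) ≤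
      D.nodeDFN (Node.vtx h) :=
    Function.argminOn_le D.nodeDFN _ (vtx_mem_verts_bodyGraph h)
  rw [← hmin] at hle ⊢
  rw [hD.dfn_injective ((WithTop.coe_le_coe.1 hle).antisymm (hD.dfn_le_of_anc hv.1))]

theorem exists_edge_bodyGraph_iff {h : V} :
    (∃ a ∈ (D.bodyGraph E h).verts, (D.bodyGraph E h).edge a (Node.vtx h)) ↔ D.IsHead E h := by
  constructor
  · rintro ⟨_, _, u, hu, v, _, huv, -, hv⟩
    cases hv
    exact ⟨u, huv, hu.1⟩
  · rintro ⟨u, hu⟩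
    have huB := mem_loopBody_of_isBack hu
    exact ⟨Node.vtx u, ⟨u, huB, rfl⟩, u, huB, h, mem_loopBody_self h, hu.1, rfl, rfl⟩

theorem ncard_verts_bodyGraph_eq_one_iff {h : V} :
    (D.bodyGraph E h).verts.ncard = 1 ↔ D.loopBody E h = {h} := by
  rw [bodyGraph, Set.ncard_image_of_injective _ fun _ _ => Node.vtx.inj, Set.ncard_eq_one]
  refine ⟨?_, fun hS => ⟨h, hS⟩⟩
  rintro ⟨g, hg⟩
  obtain rfl : h = g := hg.subset (mem_loopBody_self h)
  exact hg

/-- The closed form of the result of the top-down algorithm for the loop body of `h`. -/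
noncomputable def loopResult (D : DFForest V) (E : V → V → Prop) (h : V) : SCCResult V where
  wpo := D.innerWPO E (Node.vtx '' D.loopBody E h)
  head := Node.vtx h
  exit := D.headExit E h

/-- The exit of the strongly connected component of a vertex in a graph of level `k`. -/
noncomputable def nodeExit (D : DFForest V) (E : V → V → Prop) (k : ℕ) : Node V → Node V
  | Node.vtx u => D.repExit E k u
  | Node.exit x => Node.exit x

theorem trivialWPO_exit_wpo (x : V) :
    (trivialWPO (Node.exit x)).wpo = D.innerWPO E {Node.exit x} := by
  simp [trivialWPO, innerWPO, headExits, headStab, funext_iff]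

namespace IsLevel

variable {G : NGraph V} {k : ℕ}

theorem crossing_vtx_iff (hG : D.IsLevel E G k) (hD : D.IsDepthFirst E) {a : Node V} {v : V} :
    G.crossing (D.nodeExit E k) a (Node.vtx v) ↔
      D.crossSched E k (Node.vtx ⁻¹' G.verts) (Node.vtx ⁻¹' G.verts) a (Node.vtx v) := by
  constructor
  · rintro ⟨u | x, hu, huv, ⟨hv, hvu⟩, rfl⟩
    · refine ⟨u, hu, v, hv, ((hG.edge_vtx u v).1 huv).1, fun hrep => hvu ?_, rfl, rfl⟩
      rw [hG.scc_vtx hD hu, hrep]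
      exact ⟨v, mem_loopBody_repAt k v, rfl⟩
    · exact absurd huv (hG.not_edge_exit x _)
  · rintro ⟨u, hu, _, hv, huv, hrep, rfl, ⟨⟩⟩
    refine ⟨Node.vtx u, hu, (hG.edge_vtx u v).2 ⟨huv, hu, hv⟩, ⟨hv, fun hvu => hrep ?_⟩, rfl⟩
    rw [hG.scc_vtx hD hu] at hvu
    obtain ⟨_, hw, ⟨⟩⟩ := hvu
    exact ((hD.mem_loopBody_repAt_iff (hG.le_dfn u hu)).1 hw).symm

theorem crossing_exit_iff (hG : D.IsLevel E G k) {a : Node V} {x : V} :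
    G.crossing (D.nodeExit E k) a (Node.exit x) ↔ Node.exit x ∈ G.verts ∧
      ∃ u ∈ Node.vtx ⁻¹' G.verts, G.edge (Node.vtx u) (Node.exit x) ∧ a = D.repExit E k u := by
  constructor
  · rintro ⟨u | y, hu, hux, ⟨hx, -⟩, rfl⟩
    · exact ⟨hx, u, hu, hux, rfl⟩
    · exact absurd hux (hG.not_edge_exit y _)
  · rintro ⟨hx, u, hu, hux, rfl⟩
    refine ⟨Node.vtx u, hu, hux, ⟨hx, fun hxu => ?_⟩, rfl⟩
    have hux' : Node.vtx u ∈ G.scc (Node.exit x) := ⟨hu, hxu.2.2, hxu.2.1⟩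
    rw [hG.scc_exit hx] at hux'
    cases hux'

variable [Finite V]

theorem sccWPO_restrict_vtx (hG : D.IsLevel E G k) (hD : D.IsDepthFirst E)
    (hbody : ∀ r, Node.vtx r ∈ G.verts →
      sccWPO D (D.bodyGraph E r) (verts_bodyGraph_nonempty r) = D.loopResult E r)
    {C : Set (Node V)} (hC : G.IsMaxSCC C) {v : V} (hv : Node.vtx v ∈ C) :
    C = Node.vtx '' D.loopBody E (D.repAt E k v) ∧
      sccWPO D (G.restrict C) hC.restrict_nonempty = D.loopResult E (D.repAt E k v) := by
  have hsub := hG.loopBody_subset v (hC.1.1 hv)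
  have hCr : C = Node.vtx '' D.loopBody E (D.repAt E k v) := by
    rw [hC.eq_scc hv, hG.scc_vtx hD (hC.1.1 hv)]
  refine ⟨hCr, ?_⟩
  rw [← hbody _ (hsub ⟨_, mem_loopBody_self _, rfl⟩)]
  exact sccWPO_congr (by rw [hCr, hG.restrict_loopBody hsub]) _ _

theorem sccWPO_restrict_exit (hG : D.IsLevel E G k) {C : Set (Node V)} (hC : G.IsMaxSCC C) {x : V}
    (hx : Node.exit x ∈ C) : C = {Node.exit x} ∧
      sccWPO D (G.restrict C) hC.restrict_nonempty = trivialWPO (Node.exit x) := by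
  obtain rfl : C = {Node.exit x} := by rw [hC.eq_scc hx, hG.scc_exit (hC.1.1 hx)]
  have hmin := (G.restrict {Node.exit x}).minDFN_mem D hC.restrict_nonempty
  exact ⟨rfl, sccWPO_of_minDFN_eq_exit _ hmin.2⟩

theorem constructTD_eq (hG : D.IsLevel E G k) (hD : D.IsDepthFirst E)
    (hbody : ∀ r, Node.vtx r ∈ G.verts →
      sccWPO D (D.bodyGraph E r) (verts_bodyGraph_nonempty r) = D.loopResult E r) :
    constructTD D G = D.joinWPO E (D.nodeExit E k) G := by
  rw [constructTD]
  refine connectTD_eq_joinWPO (fun C => ?_) fun C a ha => ?_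
  · obtain ⟨a, ha⟩ := C.2.1.2.1
    cases a with
    | vtx v =>
      obtain ⟨hC, hres⟩ := hG.sccWPO_restrict_vtx hD hbody C.2 ha
      rw [hres, hC, loopResult]
    | exit x =>
      obtain ⟨hC, hres⟩ := hG.sccWPO_restrict_exit (D := D) C.2 ha
      rw [hres, hC, trivialWPO_exit_wpo]
  · cases a with
    | vtx v =>
      rw [(hG.sccWPO_restrict_vtx hD hbody C.2 ha).2, nodeExit,
        repExit_of_le (hG.le_dfn v (C.2.1.1 ha)), loopResult]
    | exit x => rw [(hG.sccWPO_restrict_exit (D := D) C.2 ha).2, trivialWPO, nodeExit]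

end IsLevel

theorem IsDepthFirst.trivialWPO_eq_loopResult (hD : D.IsDepthFirst E) {h : V}
    (hh : ¬ D.IsHead E h) : trivialWPO (Node.vtx h) = D.loopResult E h := by
  have hself : ¬ E h h := fun hE => hh ⟨h, hE, .refl⟩
  have hbody := loopBody_eq_singleton hh
  simp [trivialWPO, loopResult, innerWPO, headExits, headStab, headExit, hbody, hh, funext_iff,
    hD.headSchedTD_iff_of_loopBody_eq hbody, hself]

theorem IsDepthFirst.selfLoopWPO_eq_loopResult (hD : D.IsDepthFirst E) {h : V}
    (hh : D.IsHead E h) (hbody : D.loopBody E h = {h}) : selfLoopWPO h = D.loopResult E h := by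
  have hself : E h h := by
    obtain ⟨u, hu⟩ := hh
    obtain rfl : u = h := hbody.subset (mem_loopBody_of_isBack hu)
    exact hu.1
  simp [selfLoopWPO, loopResult, innerWPO, headExits, headStab, headExit, hbody, hh, funext_iff,
    hD.headSchedTD_iff_of_loopBody_eq hbody, hself]

theorem IsDepthFirst.crossing_breakHead_iff (hD : D.IsDepthFirst E) {h : V} {a b : Node V} :
    ((D.bodyGraph E h).breakHead h).crossing (D.nodeExit E (D.dfn h + 1)) a b ↔
      D.crossSched E (D.dfn h + 1) (D.loopBody E h \ {h}) (D.loopBody E h \ {h}) a b ∨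
        D.backSched E h (D.loopBody E h \ {h}) a b := by
  cases b with
  | vtx v =>
    rw [(hD.isLevel_breakHead h).crossing_vtx_iff hD, preimage_vtx_verts_breakHead]
    simp [backSched]
  | exit x =>
    rw [(hD.isLevel_breakHead h).crossing_exit_iff, preimage_vtx_verts_breakHead]
    simp only [crossSched, reduceCtorEq, and_false, exists_false, false_or, backSched,
      edge_breakHead_bodyGraph_exit]
    constructor
    · rintro ⟨-, u, hu, ⟨_, _, hE, ⟨⟩, rfl⟩, rfl⟩
      exact ⟨u, hu, hE, rfl, rfl⟩
    · rintro ⟨u, hu, hE, rfl, ⟨⟩⟩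
      exact ⟨by simp [NGraph.breakHead], u, hu, ⟨u, hu.1, hE, rfl, rfl⟩, rfl⟩

theorem edge_bodyGraph_vtx_iff {h : V} {b : Node V} :
    b ∈ (D.bodyGraph E h).verts ∧ (D.bodyGraph E h).edge (Node.vtx h) b ↔
      ∃ v ∈ D.loopBody E h, E h v ∧ b = Node.vtx v := by
  constructor
  · rintro ⟨-, _, _, v, hv, hE, ⟨⟩, rfl⟩
    exact ⟨v, hv, hE, rfl⟩
  · rintro ⟨v, hv, hE, rfl⟩
    exact ⟨⟨v, hv, rfl⟩, h, mem_loopBody_self h, v, hv, hE, rfl, rfl⟩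

theorem IsDepthFirst.extendTD_eq_loopResult (hD : D.IsDepthFirst E) {h : V}
    (hh : D.IsHead E h) (hbody : ∃ u ∈ D.loopBody E h, u ≠ h) :
    extendTD (D.bodyGraph E h) h
      (D.joinWPO E (D.nodeExit E (D.dfn h + 1)) ((D.bodyGraph E h).breakHead h)) =
      D.loopResult E h := by
  have hexits (a) : a ∈ D.headExits E (D.loopBody E h) ↔
      a ∈ D.headExits E (D.loopBody E h \ {h}) ∨ a = Node.exit h := by
    rw [← insert_loopBody_diff h, mem_headExits_insert_iff, insert_loopBody_diff,
      and_iff_right hh]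
  have hstab (a b) : D.headStab E (D.loopBody E h) a b ↔
      D.headStab E (D.loopBody E h \ {h}) a b ∨ a = Node.exit h ∧ b = Node.vtx h := by
    rw [← insert_loopBody_diff h, headStab_insert_iff, insert_loopBody_diff, and_iff_right hh]
  have hsched (a b) : (∃ g ∈ D.loopBody E h, D.headSchedTD E g a b) ↔
      D.headSchedTD E h a b ∨ ∃ g ∈ D.loopBody E h \ {h}, D.headSchedTD E g a b := by
    nth_rw 1 [← insert_loopBody_diff h]
    exact Set.exists_mem_insert
  simp only [extendTD, joinWPO, loopResult, innerWPO, headExit, if_pos hh, preimage_vtx_image,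
    preimage_vtx_verts_breakHead, hsched, hD.headSchedTD_iff hbody, hD.crossing_breakHead_iff,
    edge_bodyGraph_vtx_iff]
  congr 2
  · exact Set.ext fun a => (hexits a).symm
  · funext a b
    grind
  · funext a b
    exact propext (hstab a b).symm

theorem IsDepthFirst.sccWPO_bodyGraph [Finite V] (hD : D.IsDepthFirst E) (h : V) :
    sccWPO D (D.bodyGraph E h) (verts_bodyGraph_nonempty h) = D.loopResult E h := by
  induction hn : (D.loopBody E h).ncard using Nat.strong_induction_on generalizing h with
  | _ n ih =>
  subst hn
  rw [sccWPO_of_minDFN_eq_vtx _ (hD.minDFN_bodyGraph h), exists_edge_bodyGraph_iff]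
  simp only [ncard_verts_bodyGraph_eq_one_iff]
  split_ifs with hh hbody
  · exact hD.selfLoopWPO_eq_loopResult hh hbody
  · rw [(hD.isLevel_breakHead h).constructTD_eq hD fun r hr => ?_]
    · refine hD.extendTD_eq_loopResult hh ?_
      by_contra! hall
      exact hbody (Set.eq_singleton_iff_unique_mem.2 ⟨mem_loopBody_self h, hall⟩)
    · have hr : r ∈ D.loopBody E h \ {h} := (preimage_vtx_verts_breakHead h).subset hr
      refine ih _ (Set.ncard_lt_ncard ⟨loopBody_subset hr.1, fun hsub => ?_⟩) r rfl
      have hle := hD.dfn_le_of_anc (hsub (mem_loopBody_self h)).1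
      exact hle.not_gt (hD.dfn_lt_of_anc hr.1.1 (Ne.symm hr.2))
  · exact hD.trivialWPO_eq_loopResult hh

theorem IsDepthFirst.constructWPOTD_eq [Finite V] (hD : D.IsDepthFirst E) :
    ConstructWPOTD E D = D.closedWPO E (D.headSchedTD E) := by
  have hpre : Node.vtx ⁻¹' (NGraph.ofRel E).verts = Set.univ := by
    simp [NGraph.ofRel, Set.preimage_range]
  have hcross (a b) : (NGraph.ofRel E).crossing (D.nodeExit E 0) a b ↔
      D.crossSched E 0 Set.univ Set.univ a b := by
    cases b with
    | vtx v => rw [isLevel_ofRel.crossing_vtx_iff hD, hpre]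
    | exit x =>
      rw [isLevel_ofRel.crossing_exit_iff]
      simp [NGraph.ofRel, crossSched]
  rw [ConstructWPOTD, isLevel_ofRel.constructTD_eq hD fun r _ => hD.sccWPO_bodyGraph r]
  simp only [joinWPO, innerWPO, hpre, hcross, Set.mem_univ, true_and, closedWPO]
  rfl

end DFForest

/-! ### The states of the bottom-up algorithm -/

namespace DFForest

variable {V : Type*} {D : DFForest V} {E : V → V → Prop}

/-- The cross and forward edges whose lowest common ancestor is `a`, where `none` is the virtual
root: the edges stored in `R[a]`. -/
def crossAt (D : DFForest V) (E : V → V → Prop) (a : Option V) : Set (V × V) :=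
  {e | D.IsCrossFwd E e.1 e.2 ∧
    match a with
    | some h => D.IsLCA h e.1 e.2
    | none => ¬ ∃ b, D.Anc b e.1 ∧ D.Anc b e.2}

/-- The edges stored at `a` are restored when precisely the vertices with depth-first number at
least `restoreStage a` have been processed. -/
noncomputable def restoreStage (D : DFForest V) : Option V → ℕ
  | none => 0
  | some a => D.dfn a + 1

/-- The pair `(u, v)` is recorded in `O[w]` when the edges of stage at least `j` have been
restored. -/
def RecordedAt (D : DFForest V) (E : V → V → Prop) (j : ℕ) (w u v : V) : Prop :=
  (D.parent v = some u ∧ w = v) ∨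
    ∃ a, (u, v) ∈ D.crossAt E a ∧ j ≤ D.restoreStage a ∧ w = D.repAt E (D.restoreStage a) v

theorem IsDepthFirst.not_isBack_of_parent (hD : D.IsDepthFirst E) {u v : V}
    (huv : D.parent v = some u) : ¬ D.IsBack E u v := fun h =>
  (hD.dfn_le_of_anc h.2).not_gt (hD.dfn_lt_of_parent huv)

theorem IsDepthFirst.edge_and_not_isCrossFwd_iff (hD : D.IsDepthFirst E) {u v : V} :
    E u v ∧ ¬ D.IsCrossFwd E u v ↔ D.parent v = some u ∨ D.IsBack E u v := by
  have htree : D.parent v = some u → E u v := hD.edge_of_parent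
  simp only [IsCrossFwd, IsBack]
  tauto

theorem IsDepthFirst.depth_lt_of_anc (hD : D.IsDepthFirst E) {a b : V} (hab : D.Anc a b)
    (hne : a ≠ b) : D.depth a < D.depth b := by
  have := hD.finite
  refine Set.ncard_lt_ncard ⟨fun c hc => Anc.trans hc hab, fun hsub => ?_⟩ (Set.toFinite _)
  have hba : D.Anc b a := hsub (show D.Anc b b from .refl)
  exact (hD.dfn_le_of_anc hba).not_gt (hD.dfn_lt_of_anc hab hne)

theorem IsDepthFirst.anc_of_isLCA (hD : D.IsDepthFirst E) {a b u v : V}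
    (ha : D.IsLCA a u v) (hu : D.Anc b u) (hv : D.Anc b v) : D.Anc b a := by
  rcases hu.total ha.1 with h | h
  · exact h
  · obtain rfl : a = b := by
      by_contra hne
      exact (ha.2.2 b hu hv).not_gt (hD.depth_lt_of_anc h hne)
    exact .refl

theorem IsDepthFirst.exists_isLCA (hD : D.IsDepthFirst E) {b u v : V} (hu : D.Anc b u)
    (hv : D.Anc b v) : ∃ a, D.IsLCA a u v := by
  have := hD.finite
  obtain ⟨a, ha, hmax⟩ := Set.exists_max_image {a | D.Anc a u ∧ D.Anc a v} D.depth
    (Set.toFinite _) ⟨b, hu, hv⟩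
  exact ⟨a, ha.1, ha.2, fun c hc hc' => hmax c ⟨hc, hc'⟩⟩

theorem IsDepthFirst.exists_mem_crossAt (hD : D.IsDepthFirst E) {u v : V}
    (huv : D.IsCrossFwd E u v) : ∃ a, (u, v) ∈ D.crossAt E a := by
  by_cases h : ∃ b, D.Anc b u ∧ D.Anc b v
  · obtain ⟨b, hu, hv⟩ := h
    obtain ⟨a, ha⟩ := hD.exists_isLCA hu hv
    exact ⟨some a, huv, ha⟩
  · exact ⟨none, huv, h⟩

theorem IsDepthFirst.dfn_lt_restoreStage (hD : D.IsDepthFirst E) {u v b : V} {a : Option V}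
    (ha : (u, v) ∈ D.crossAt E a) (hu : D.Anc b u) (hv : D.Anc b v) :
    D.dfn b < D.restoreStage a := by
  cases a with
  | none => exact absurd ⟨b, hu, hv⟩ ha.2
  | some a => exact Nat.lt_succ_of_le (hD.dfn_le_of_anc (hD.anc_of_isLCA ha.2 hu hv))

theorem IsDepthFirst.anc_of_dfn_lt_restoreStage (hD : D.IsDepthFirst E) {u v b : V}
    {a : Option V} (ha : (u, v) ∈ D.crossAt E a) (hv : D.Anc b v)
    (hb : D.dfn b < D.restoreStage a) : D.Anc b u := by
  cases a with
  | none => exact absurd hb (Nat.not_lt_zero _)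
  | some a => exact (hD.anc_of_dfn_le hv ha.2.2.1 (Nat.le_of_lt_succ hb)).trans ha.2.1

theorem IsDepthFirst.edge_of_recordedAt (hD : D.IsDepthFirst E) {j : ℕ} {w u v : V}
    (h : D.RecordedAt E j w u v) : E u v := by
  rcases h with ⟨h, _⟩ | ⟨a, ha, _⟩
  · exact hD.edge_of_parent h
  · exact ha.1.1

theorem IsDepthFirst.not_anc_of_recordedAt (hD : D.IsDepthFirst E) {j : ℕ} {w u v : V}
    (h : D.RecordedAt E j w u v) : ¬ D.Anc w u := by
  rcases h with ⟨h, rfl⟩ | ⟨a, ha, _, rfl⟩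
  · exact fun hanc => (hD.dfn_le_of_anc hanc).not_gt (hD.dfn_lt_of_parent h)
  · intro hanc
    obtain ⟨hbody, hr | hr⟩ :=
      repAt_mem_enclosingHeads (D := D) (E := E) (D.restoreStage a) v
    · exact ha.1.2.2 (hr ▸ hanc)
    · exact hr.not_gt (hD.dfn_lt_restoreStage ha hanc hbody.1)

theorem IsDepthFirst.repAt_of_recordedAt (hD : D.IsDepthFirst E) {k : ℕ} {r u v : V}
    (hr : D.repAt E k r = r) (h : D.RecordedAt E k r u v) : D.repAt E k v = r := by
  rcases h with ⟨-, rfl⟩ | ⟨a, -, hk, rfl⟩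
  · exact hr
  · obtain ⟨hbody, hle⟩ := repAt_mem_enclosingHeads (D := D) (E := E) (D.restoreStage a) v
    rw [hD.repAt_eq_repAt ⟨hbody, hle.imp_right hk.trans⟩, hr]

theorem IsDepthFirst.repAt_ne_of_recordedAt (hD : D.IsDepthFirst E) {k : ℕ} {r u v : V}
    (hr : D.repAt E k r = r) (h : D.RecordedAt E k r u v) :
    D.repAt E k u ≠ D.repAt E k v := by
  intro he
  refine hD.not_anc_of_recordedAt h ?_
  rw [← hD.repAt_of_recordedAt hr h, ← he]
  exact (mem_loopBody_repAt k u).1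

theorem IsDepthFirst.recordedAt_repAt (hD : D.IsDepthFirst E) {k : ℕ} {u v : V}
    (huv : E u v) (hk : k ≤ D.dfn v) (hne : D.repAt E k u ≠ D.repAt E k v)
    (hstage : ∀ a, (u, v) ∈ D.crossAt E a → k ≤ D.restoreStage a) :
    D.RecordedAt E k (D.repAt E k v) u v := by
  have hbody := mem_loopBody_repAt (D := D) (E := E) k v
  have hnot : ¬ D.Anc (D.repAt E k v) u := fun hu => hne (hD.repAt_eq_of_edge huv hu hk)
  by_cases hp : D.parent v = some u
  · refine .inl ⟨hp, ?_⟩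
    by_contra hrv
    exact hnot (hbody.1.parent hrv hp)
  · obtain ⟨a, ha⟩ := hD.exists_mem_crossAt ⟨huv, hp, fun h => hnot (hbody.1.trans h)⟩
    refine .inr ⟨a, ha, hstage a ha, (hD.repAt_eq_of_le (hstage a ha) ⟨hbody, .inr ?_⟩).symm⟩
    by_contra! hlt
    exact hnot (hD.anc_of_dfn_lt_restoreStage ha hbody.1 hlt)

/-- The state of the bottom-up algorithm when the edges of stage at least `j` have been restored and
the vertices with depth-first number at least `k` have been processed. -/
noncomputable def buState (D : DFForest V) (E : V → V → Prop) (j k : ℕ) : BUState V where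
  edge u w := D.IsBack E u w ∨ ∃ v, D.RecordedAt E j w u v
  exits := D.headExits E {g | k ≤ D.dfn g}
  sched a b := ∃ g ∈ {g | k ≤ D.dfn g}, D.headSched E g a b
  stab := D.headStab E {g | k ≤ D.dfn g}
  rep := D.repAt E k
  exit := D.exitAt E k
  R := D.crossAt E
  O w := {e | D.RecordedAt E j w e.1 e.2}

theorem IsDepthFirst.dfn_lt_length (hD : D.IsDepthFirst E) (v : V) :
    D.dfn v < D.order.length := by
  classical
  exact List.idxOf_lt_length_iff.2 (hD.mem_order v)

theorem IsDepthFirst.restoreStage_le_length (hD : D.IsDepthFirst E) (a : Option V) :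
    D.restoreStage a ≤ D.order.length := by
  cases a with
  | none => exact Nat.zero_le _
  | some a => exact hD.dfn_lt_length a

theorem IsDepthFirst.restoreStage_injective (hD : D.IsDepthFirst E) :
    Function.Injective D.restoreStage := by
  rintro (_ | a) (_ | b) hab
  · rfl
  · exact absurd hab (Nat.succ_ne_zero _).symm
  · exact absurd hab (Nat.succ_ne_zero _)
  · exact congrArg some (hD.dfn_injective (Nat.succ_injective hab))

theorem IsDepthFirst.recordedAt_length_succ_iff (hD : D.IsDepthFirst E) {w u v : V} :
    D.RecordedAt E (D.order.length + 1) w u v ↔ D.parent v = some u ∧ w = v :=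
  or_iff_left fun ⟨a, _, ha, _⟩ => (hD.restoreStage_le_length a).not_gt ha

theorem IsDepthFirst.recordedAt_restoreStage_iff (hD : D.IsDepthFirst E) {a : Option V}
    {w u v : V} :
    D.RecordedAt E (D.restoreStage a) w u v ↔
      D.RecordedAt E (D.restoreStage a + 1) w u v ∨
        (u, v) ∈ D.crossAt E a ∧ w = D.repAt E (D.restoreStage a) v := by
  constructor
  · rintro (h | ⟨b, hb, hle, hw⟩)
    · exact .inl (.inl h)
    · rcases hle.eq_or_lt with he | hlt
      · cases hD.restoreStage_injective he
        exact .inr ⟨hb, hw⟩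
      · exact .inl (.inr ⟨b, hb, hlt, hw⟩)
  · rintro ((h | ⟨b, hb, hle, hw⟩) | ⟨h, hw⟩)
    · exact .inl h
    · exact .inr ⟨b, hb, Nat.le_of_succ_le hle, hw⟩
    · exact .inr ⟨a, h, le_rfl, hw⟩

theorem IsDepthFirst.init_eq (hD : D.IsDepthFirst E) :
    BUState.init E D = D.buState E (D.order.length + 1) D.order.length := by
  have hnone : {g | D.order.length ≤ D.dfn g} = ∅ :=
    Set.eq_empty_of_forall_notMem fun g => (hD.dfn_lt_length g).not_ge
  simp only [BUState.init, BUState.removeAllCrossForwardEdges, BUState.start, buState,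
    BUState.mk.injEq, hD.recordedAt_length_succ_iff, hnone, headExits,
    Set.mem_empty_iff_false, false_and, exists_false, Set.empty_union]
  refine ⟨?_, rfl, trivial, ?_, ?_, ?_, rfl, ?_⟩
  · funext u w
    rw [hD.edge_and_not_isCrossFwd_iff]
    simp [or_comm]
  · funext a b
    simp [headStab]
  · funext v
    exact (hD.repAt_of_dfn_lt (hD.dfn_lt_length v)).symm
  · funext v
    exact (if_neg (hD.dfn_lt_length v).not_ge).symm
  · funext w
    ext ⟨u, v⟩
    constructor
    · rintro ⟨rfl, hE, hback⟩
      exact ⟨(hD.edge_and_not_isCrossFwd_iff.1 hE).resolve_right hback, rfl⟩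
    · rintro ⟨hp, rfl⟩
      exact ⟨rfl, hD.edge_and_not_isCrossFwd_iff.2 (.inl hp), hD.not_isBack_of_parent hp⟩

theorem IsDepthFirst.restore_buState (hD : D.IsDepthFirst E) (a : Option V) :
    (D.buState E (D.restoreStage a + 1) (D.restoreStage a)).restoreCrossForwardEdges a =
      D.buState E (D.restoreStage a) (D.restoreStage a) := by
  simp only [BUState.restoreCrossForwardEdges, buState, BUState.mk.injEq, true_and]
  constructor
  · funext u w
    simp only [hD.recordedAt_restoreStage_iff, exists_or, or_assoc]
  · funext w
    ext ⟨u, v⟩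
    rw [Set.mem_ofPred_eq, hD.recordedAt_restoreStage_iff]
    exact or_congr_right (and_congr_right fun _ => eq_comm)

/-- The state in which the search for the components nested in the component of `h` starts. -/
noncomputable abbrev entryState (D : DFForest V) (E : V → V → Prop) (h : V) : BUState V :=
  D.buState E (D.dfn h + 1) (D.dfn h + 1)

end DFForest

/-! ### The worklist search -/

namespace BUState

variable {V : Type*} {E : V → V → Prop} {D : DFForest V} {h : V} {s : BUState V}

/-- The representatives of the sources of the non-back edges into `v`, which are put on the
worklist when `v` is taken from it. -/
def preds (E : V → V → Prop) (D : DFForest V) (s : BUState V) (v : V) : Set V :=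
  {q | ∃ p, s.edge p v ∧ ¬ D.IsBack E p v ∧ q = s.rep p}

/-- The sets that contain `W` and are closed under the search for nested components from `h`. -/
def searchClosed (E : V → V → Prop) (D : DFForest V) (h : V) (s : BUState V) (W : Set V) :
    Set (Set V) :=
  {M | W ⊆ M ∧ ∀ v ∈ M, s.preds E D v \ {h} ⊆ M}

theorem SearchStep.exists_pop {c d : Set V × Set V} (hcd : SearchStep E D h s c d) :
    ∃ v ∈ c.1, d.2 = c.2 ∪ {v} ∧ d.1 ∪ d.2 = c.1 ∪ c.2 ∪ s.preds E D v \ {h} := by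
  obtain ⟨W, N, v, hv⟩ := hcd
  refine ⟨v, hv, rfl, ?_⟩
  ext x
  by_cases hxv : x = v
  · simp [hxv, hv]
  · simp only [preds, Set.mem_union, Set.mem_sdiff, Set.mem_singleton_iff, Set.mem_ofPred_eq]
    grind

theorem isLeast_of_searchStep {W N : Set V}
    (hrun : Relation.ReflTransGen (SearchStep E D h s) (W, ∅) (∅, N)) :
    IsLeast (s.searchClosed E D h W) N := by
  have hinv (c : Set V × Set V) (hc : Relation.ReflTransGen (SearchStep E D h s) (W, ∅) c) :
      W ⊆ c.1 ∪ c.2 ∧ (∀ v ∈ c.2, s.preds E D v \ {h} ⊆ c.1 ∪ c.2) ∧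
        ∀ M ∈ s.searchClosed E D h W, c.1 ∪ c.2 ⊆ M := by
    induction hc with
    | refl => exact ⟨by simp, by simp, fun M hM => by simpa using hM.1⟩
    | tail _ hstep ih =>
      obtain ⟨hW, hclosed, hleast⟩ := ih
      obtain ⟨v, hv, hN, hunion⟩ := hstep.exists_pop
      rw [hunion, hN]
      refine ⟨hW.trans Set.subset_union_left, ?_, fun M hM => ?_⟩
      · rintro w (hw | rfl)
        · exact (hclosed w hw).trans Set.subset_union_left
        · exact Set.subset_union_right
      · exact Set.union_subset (hleast M hM) (hM.2 v (hleast M hM (.inl hv)))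
  simpa [IsLeast, searchClosed, mem_lowerBounds, and_assoc] using hinv _ hrun

theorem exists_searchStep_result [Finite V] (W N : Set V) (hWN : Disjoint W N) :
    ∃ N', Relation.ReflTransGen (SearchStep E D h s) (W, N) (∅, N') := by
  induction hn : (Nᶜ).ncard using Nat.strong_induction_on generalizing W N with
  | _ n ih =>
  subst hn
  rcases W.eq_empty_or_nonempty with rfl | ⟨v, hv⟩
  · exact ⟨N, .refl⟩
  have hlt : (N ∪ {v})ᶜ.ncard < Nᶜ.ncard := Set.ncard_lt_ncard
    ⟨Set.compl_subset_compl.2 Set.subset_union_left,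
      fun hsub => hsub (Set.disjoint_left.1 hWN hv) (.inr rfl)⟩
  have hdisj : Disjoint ((W \ {v}) ∪ {q | ∃ p, s.edge p v ∧ ¬ D.IsBack E p v ∧ q = s.rep p ∧
      q ∉ (N ∪ {v}) ∪ {h} ∪ (W \ {v})}) (N ∪ {v}) := by
    refine Set.disjoint_left.2 ?_
    rintro x (hx | ⟨_, _, _, _, hx⟩) hxN
    · exact hxN.elim (Set.disjoint_left.1 hWN hx.1) hx.2
    · exact hx (.inl (.inl hxN))
  obtain ⟨N', hN'⟩ := ih _ hlt _ _ hdisj rfl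
  exact ⟨N', .head (.pop W N v hv) hN'⟩

theorem findNestedSCCs_iff_of_isLeast [Finite V] {M N P : Set V}
    (hM : IsLeast (s.searchClosed E D h (s.backReps E D h \ {h})) M) :
    FindNestedSCCs E D h s N P ↔ N = M ∧ P = s.backReps E D h := by
  constructor
  · rintro ⟨rfl, hN⟩
    exact ⟨(isLeast_of_searchStep hN).unique hM, rfl⟩
  · rintro ⟨rfl, rfl⟩
    obtain ⟨N', hN'⟩ := exists_searchStep_result (E := E) (D := D) (h := h) (s := s)
      (s.backReps E D h \ {h}) ∅ (Set.disjoint_empty _)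
    rw [(isLeast_of_searchStep hN').unique hM] at hN'
    exact ⟨rfl, hN'⟩

end BUState

namespace DFForest

variable {V : Type*} {D : DFForest V} {E : V → V → Prop}

/-- The representatives of the components nested in the component with head `h`. -/
def nestedReps (D : DFForest V) (E : V → V → Prop) (h : V) : Set V :=
  D.repAt E (D.dfn h + 1) '' (D.loopBody E h \ {h})

theorem IsDepthFirst.mem_nestedReps_iff (hD : D.IsDepthFirst E) {h r : V} :
    r ∈ D.nestedReps E h ↔ r ∈ D.loopBody E h \ {h} ∧ D.repAt E (D.dfn h + 1) r = r := by
  constructor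
  · rintro ⟨v, hv, rfl⟩
    exact ⟨hD.repAt_mem_loopBody_diff hv, hD.repAt_repAt _ _⟩
  · rintro ⟨hr, he⟩
    exact ⟨r, hr, he⟩

theorem IsDepthFirst.recordedAt_iff_of_mem_nestedReps (hD : D.IsDepthFirst E) {h r u v : V}
    (hr : r ∈ D.nestedReps E h) :
    D.RecordedAt E (D.dfn h + 1) r u v ↔
      E u v ∧ u ∈ D.loopBody E h ∧ v ∈ D.loopBody E h \ {h} ∧
        D.repAt E (D.dfn h + 1) u ≠ D.repAt E (D.dfn h + 1) v ∧
        D.repAt E (D.dfn h + 1) v = r := by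
  obtain ⟨hrh, hrr⟩ := hD.mem_nestedReps_iff.1 hr
  constructor
  · intro hrec
    have huv := hD.edge_of_recordedAt hrec
    have hvr := hD.repAt_of_recordedAt hrr hrec
    have hv : v ∈ D.loopBody E h \ {h} := by
      refine ⟨loopBody_subset hrh.1 (hvr ▸ mem_loopBody_repAt _ v), ?_⟩
      rintro rfl
      exact hrh.2 (hvr.symm.trans (hD.repAt_succ_self v))
    refine ⟨huv, mem_loopBody_of_edge hv.1 huv ?_, hv, hD.repAt_ne_of_recordedAt hrr hrec, hvr⟩
    rcases hrec with ⟨hp, -⟩ | ⟨a, ha, hstage, -⟩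
    · exact hv.1.1.parent (Ne.symm hv.2) hp
    · exact hD.anc_of_dfn_lt_restoreStage ha hv.1.1 hstage
  · rintro ⟨huv, hu, hv, hne, rfl⟩
    exact hD.recordedAt_repAt huv (hD.dfn_lt_of_anc hv.1.1 (Ne.symm hv.2)) hne fun a ha =>
      hD.dfn_lt_restoreStage ha hu.1 hv.1.1

theorem IsDepthFirst.mem_preds_buState_iff (hD : D.IsDepthFirst E) {j k : ℕ} {r q : V} :
    q ∈ (D.buState E j k).preds E D r ↔
      ∃ u v, D.RecordedAt E j r u v ∧ q = D.repAt E k u := by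
  constructor
  · rintro ⟨u, hb | ⟨v, hv⟩, hnb, rfl⟩
    · exact absurd hb hnb
    · exact ⟨u, v, hv, rfl⟩
  · rintro ⟨u, v, hv, rfl⟩
    exact ⟨u, .inr ⟨v, hv⟩, fun hb => hD.not_anc_of_recordedAt hv hb.2, rfl⟩

theorem IsDepthFirst.nestedReps_mem_searchClosed (hD : D.IsDepthFirst E) (h : V) :
    D.nestedReps E h ∈ (D.entryState E h).searchClosed E D h
      ((D.entryState E h).backReps E D h \ {h}) := by
  constructor
  · rintro _ ⟨⟨p, hp, rfl⟩, hne⟩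
    refine ⟨p, ⟨mem_loopBody_of_isBack hp, ?_⟩, rfl⟩
    rintro rfl
    exact hne (hD.repAt_succ_self p)
  · rintro r hr q ⟨hq, hqh⟩
    obtain ⟨u, v, huv, rfl⟩ := hD.mem_preds_buState_iff.1 hq
    refine ⟨u, ⟨((hD.recordedAt_iff_of_mem_nestedReps hr).1 huv).2.1, ?_⟩, rfl⟩
    rintro rfl
    exact hqh (hD.repAt_succ_self u)

theorem IsDepthFirst.nestedReps_subset (hD : D.IsDepthFirst E) {h : V} {M : Set V}
    (hM : M ∈ (D.entryState E h).searchClosed E D h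
      ((D.entryState E h).backReps E D h \ {h})) : D.nestedReps E h ⊆ M := by
  rintro _ ⟨v, ⟨hv, hvh⟩, rfl⟩
  have hpath := hD.reachable_of_mem_loopBody hv (mem_loopBody_self h)
  induction hpath using Relation.ReflTransGen.head_induction_on with
  | refl => exact absurd rfl hvh
  | @head u w huw _ ih =>
    obtain ⟨hE, hu, hw⟩ := huw
    have hrep := hD.repAt_mem_loopBody_diff ⟨hu, hvh⟩
    by_cases hwh : w = h
    · subst hwh
      exact hM.1 ⟨⟨u, ⟨hE, hu.1⟩, rfl⟩, hrep.2⟩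
    · have hwM := ih hw hwh
      by_cases he : D.repAt E (D.dfn h + 1) u = D.repAt E (D.dfn h + 1) w
      · rwa [he]
      · refine hM.2 _ hwM ⟨hD.mem_preds_buState_iff.2 ⟨u, w, ?_, rfl⟩, hrep.2⟩
        rw [hD.recordedAt_iff_of_mem_nestedReps ⟨w, ⟨hw, hwh⟩, rfl⟩]
        exact ⟨hE, hu, ⟨hw, hwh⟩, he, rfl⟩

theorem IsDepthFirst.findNestedSCCs_iff (hD : D.IsDepthFirst E) {h : V} {N P : Set V} :
    BUState.FindNestedSCCs E D h (D.entryState E h) N P ↔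
      N = D.nestedReps E h ∧ P = (D.entryState E h).backReps E D h := by
  have := hD.finite
  exact BUState.findNestedSCCs_iff_of_isLeast
    ⟨hD.nestedReps_mem_searchClosed h, fun M hM => hD.nestedReps_subset hM⟩

end DFForest

/-! ### The result of the bottom-up algorithm -/

namespace DFForest

variable {V : Type*} {D : DFForest V} {E : V → V → Prop}

theorem newSched_buState_iff {k : ℕ} {w : V} {a b : Node V} :
    (D.buState E k k).newSched E D false w a b ↔
      ∃ u v, D.RecordedAt E k w u v ∧ a = D.repExit E k u ∧ b = Node.vtx v :=
  or_iff_left fun h => Bool.false_ne_true h.1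

theorem IsDepthFirst.exists_newSched_nestedReps_iff (hD : D.IsDepthFirst E) {h : V}
    {a b : Node V} :
    (∃ r ∈ D.nestedReps E h, (D.entryState E h).newSched E D false r a b) ↔
      D.crossSched E (D.dfn h + 1) (D.loopBody E h) (D.loopBody E h \ {h}) a b := by
  simp only [newSched_buState_iff]
  constructor
  · rintro ⟨r, hr, u, v, hrec, ha, hb⟩
    obtain ⟨huv, hu, hv, hne, -⟩ := (hD.recordedAt_iff_of_mem_nestedReps hr).1 hrec
    exact ⟨u, hu, v, hv, huv, hne, ha, hb⟩
  · rintro ⟨u, hu, v, hv, huv, hne, ha, hb⟩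
    have hr : D.repAt E (D.dfn h + 1) v ∈ D.nestedReps E h := ⟨v, hv, rfl⟩
    exact ⟨_, hr, u, v,
      (hD.recordedAt_iff_of_mem_nestedReps hr).2 ⟨huv, hu, hv, hne, rfl⟩, ha, hb⟩

theorem IsDepthFirst.exists_backReps_iff (hD : D.IsDepthFirst E) {h : V} {a b : Node V} :
    (∃ q ∈ (D.entryState E h).backReps E D h,
      a = D.repExit E (D.dfn h + 1) q ∧ b = Node.exit h) ↔
      D.backSched E h (D.loopBody E h) a b := by
  have hrep (p : V) :
      D.repExit E (D.dfn h + 1) (D.repAt E (D.dfn h + 1) p) = D.repExit E (D.dfn h + 1) p := by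
    rw [repExit, hD.repAt_repAt, repExit]
  constructor
  · rintro ⟨_, ⟨p, hp, rfl⟩, ha, hb⟩
    exact ⟨p, mem_loopBody_of_isBack hp, hp.1, ha.trans (hrep p), hb⟩
  · rintro ⟨p, hp, hph, ha, hb⟩
    exact ⟨_, ⟨p, ⟨hph, hp.1⟩, rfl⟩, ha.trans (hrep p).symm, hb⟩

theorem IsDepthFirst.setOf_dfn_le (hD : D.IsDepthFirst E) (h : V) :
    {g | D.dfn h ≤ D.dfn g} = insert h {g | D.dfn h + 1 ≤ D.dfn g} := by
  ext g
  rw [Set.mem_ofPred_eq, le_iff_eq_or_lt, hD.dfn_injective.eq_iff, eq_comm]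
  rfl

theorem IsDepthFirst.mergeAll_nestedReps (hD : D.IsDepthFirst E) (h : V) :
    (D.entryState E h).mergeAll (D.nestedReps E h) h = D.repAt E (D.dfn h) := by
  classical
  funext w
  by_cases hw : w ∈ D.loopBody E h
  · rw [hD.repAt_dfn hw]
    rcases eq_or_ne w h with rfl | hwh
    · exact ite_eq_left_iff.2 fun _ => hD.repAt_succ_self w
    · exact if_pos ⟨_, ⟨w, ⟨hw, hwh⟩, rfl⟩, .inl (hD.repAt_repAt _ w).symm⟩
  · rw [hD.repAt_dfn_of_notMem hw]
    refine if_neg ?_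
    rintro ⟨r, hr, hwr⟩
    obtain ⟨⟨hrh, -⟩, hrr⟩ := hD.mem_nestedReps_iff.1 hr
    have hrep : D.repAt E (D.dfn h + 1) w = r ∨ D.repAt E (D.dfn h + 1) w = h :=
      hwr.imp (·.trans hrr) (·.trans (hD.repAt_succ_self h))
    have hmem : D.repAt E (D.dfn h + 1) w ∈ D.loopBody E h := by
      rcases hrep with he | he <;> rw [he]
      · exact hrh
      · exact mem_loopBody_self h
    exact hw (loopBody_subset hmem (mem_loopBody_repAt _ w))

open Classical in
theorem IsDepthFirst.update_exitAt (hD : D.IsDepthFirst E) (h : V) :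
    Function.update (D.exitAt E (D.dfn h + 1)) h (D.headExit E h) = D.exitAt E (D.dfn h) := by
  refine Function.update_eq_iff.2 ⟨(if_pos le_rfl).symm, fun r hr => if_congr ?_ rfl rfl⟩
  rw [Nat.succ_le_iff, lt_iff_le_and_ne, and_iff_left (hD.dfn_injective.ne hr.symm)]

theorem IsDepthFirst.addComponent_buState (hD : D.IsDepthFirst E) {h : V} (hh : D.IsHead E h) :
    (D.entryState E h).addComponent E D false h (D.nestedReps E h)
      ((D.entryState E h).backReps E D h) = D.buState E (D.dfn h + 1) (D.dfn h) := by
  have hexit : D.headExit E h = Node.exit h := if_pos hh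
  rw [BUState.addComponent, hD.mergeAll_nestedReps, ← hexit]
  simp only [buState, hD.update_exitAt, hD.setOf_dfn_le, BUState.mk.injEq, and_true, true_and]
  refine ⟨?_, ?_, ?_⟩
  · ext a
    simp [mem_headExits_insert_iff, hh, hexit, or_comm]
  · funext a b
    rw [Set.exists_mem_insert, or_comm (a := D.headSched E h a b), hexit]
    exact congrArg _ (propext (or_congr hD.exists_newSched_nestedReps_iff hD.exists_backReps_iff))
  · funext a b
    simp [headStab_insert_iff, hh, hexit]

theorem not_headSched {h : V} (hh : ¬ D.IsHead E h) (a b : Node V) : ¬ D.headSched E h a b := by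
  rintro (⟨_, _, v, hv, _⟩ | ⟨u, hu, huh, _⟩)
  · simp [loopBody_eq_singleton hh] at hv
  · exact hh ⟨u, huh, hu.1⟩

theorem IsDepthFirst.entryState_of_not_isHead (hD : D.IsDepthFirst E) {h : V}
    (hh : ¬ D.IsHead E h) : D.entryState E h = D.buState E (D.dfn h + 1) (D.dfn h) := by
  have hexit : D.headExit E h = D.exitAt E (D.dfn h + 1) h :=
    (if_neg hh).trans (if_neg (Nat.lt_succ_self _).not_ge).symm
  have hnested : D.nestedReps E h = ∅ := by simp [nestedReps, loopBody_eq_singleton hh]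
  simp only [buState, hD.setOf_dfn_le, ← hD.update_exitAt, ← hD.mergeAll_nestedReps, hexit,
    hnested, Function.update_eq_self, BUState.mk.injEq, true_and, and_true]
  refine ⟨?_, ?_, ?_, ?_⟩
  · ext a
    simp [mem_headExits_insert_iff, hh]
  · funext a b
    simp [not_headSched hh]
  · funext a b
    simp [headStab_insert_iff, hh]
  · funext w
    simp [BUState.mergeAll]

theorem backReps_eq_empty_iff {h : V} {s : BUState V} :
    s.backReps E D h = ∅ ↔ ¬ D.IsHead E h := by
  rw [← Set.not_nonempty_iff_eq_empty]
  exact not_congr ⟨fun ⟨_, p, hp, _⟩ => ⟨p, hp⟩, fun ⟨p, hp⟩ => ⟨_, p, hp, rfl⟩⟩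

theorem IsDepthFirst.constructWPOForSCC_iff (hD : D.IsDepthFirst E) {h : V} {t : BUState V} :
    BUState.ConstructWPOForSCC E D false h (D.entryState E h) t ↔
      t = D.buState E (D.dfn h + 1) (D.dfn h) := by
  simp only [BUState.ConstructWPOForSCC, hD.findNestedSCCs_iff, and_assoc, exists_and_left,
    exists_eq_left, ne_eq, backReps_eq_empty_iff, not_not]
  by_cases hh : D.IsHead E h
  · simp [hh, hD.addComponent_buState hh]
  · simp [hh, ← hD.entryState_of_not_isHead hh]

theorem IsDepthFirst.mainLoop_take_iff (hD : D.IsDepthFirst E) {m : ℕ}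
    (hm : m ≤ D.order.length) {s : BUState V} :
    BUState.MainLoop E D false (D.order.take m).reverse (D.buState E (m + 1) m) s ↔
      s = D.buState E 1 0 := by
  induction m with
  | zero =>
    constructor
    · rintro ⟨⟩
      rfl
    · rintro rfl
      exact .nil _
  | succ m ih =>
    obtain ⟨h, hh⟩ : ∃ h, D.order[m] = h := ⟨_, rfl⟩
    obtain rfl : D.dfn h = m := by
      classical
      rw [← hh]
      exact hD.nodup.idxOf_getElem m hm
    have hrestore : (D.buState E (D.dfn h + 1 + 1) (D.dfn h + 1)).restoreCrossForwardEdges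
        (some h) = D.entryState E h := hD.restore_buState (some h)
    rw [List.take_succ_eq_append_getElem hm, List.reverse_append, hh, List.reverse_singleton,
      List.singleton_append, ← ih (Nat.le_of_succ_le hm)]
    constructor
    · rintro (_ | ⟨_, _, _, t, _, hstep, hrest⟩)
      rw [hrestore, hD.constructWPOForSCC_iff] at hstep
      rwa [hstep] at hrest
    · intro hrest
      exact .cons _ _ _ _ _ (hrestore ▸ hD.constructWPOForSCC_iff.2 rfl) hrest

theorem IsDepthFirst.mainLoop_iff (hD : D.IsDepthFirst E) {s : BUState V} :
    BUState.MainLoop E D false D.order.reverse (BUState.init E D) s ↔ s = D.buState E 1 0 := by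
  rw [hD.init_eq, ← hD.mainLoop_take_iff le_rfl, List.take_length]

theorem IsDepthFirst.exists_newSched_top_iff (hD : D.IsDepthFirst E) {a b : Node V} :
    (∃ r, D.repAt E 0 r = r ∧ (D.buState E 0 0).newSched E D false r a b) ↔
      D.crossSched E 0 Set.univ Set.univ a b := by
  simp only [newSched_buState_iff]
  constructor
  · rintro ⟨r, hr, u, v, hrec, ha, hb⟩
    exact ⟨u, trivial, v, trivial, hD.edge_of_recordedAt hrec,
      hD.repAt_ne_of_recordedAt hr hrec, ha, hb⟩
  · rintro ⟨u, -, v, -, huv, hne, ha, hb⟩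
    exact ⟨_, hD.repAt_repAt 0 v, u, v,
      hD.recordedAt_repAt huv (Nat.zero_le _) hne fun _ _ => Nat.zero_le _, ha, hb⟩

theorem IsDepthFirst.connectWPOsOfMaximalSCCs_buState (hD : D.IsDepthFirst E) :
    (D.buState E 0 0).connectWPOsOfMaximalSCCs E D false = D.closedWPO E (D.headSched E) := by
  have huniv : {g | 0 ≤ D.dfn g} = Set.univ := Set.eq_univ_of_forall fun g => Nat.zero_le _
  refine WPOTuple.ext rfl ?_ ?_ ?_
  · exact congrArg (D.headExits E) huniv
  · funext a b
    refine propext (or_congr ?_ hD.exists_newSched_top_iff)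
    simp [buState]
  · exact congrArg (D.headStab E) huniv

theorem IsDepthFirst.constructWPOBU_iff (hD : D.IsDepthFirst E) {W : WPOTuple V} :
    ConstructWPOBU E D false W ↔ W = D.closedWPO E (D.headSched E) := by
  have hrestore : (D.buState E 1 0).restoreCrossForwardEdges none = D.buState E 0 0 :=
    hD.restore_buState none
  simp only [ConstructWPOBU, hD.mainLoop_iff, exists_eq_left, hrestore,
    hD.connectWPOsOfMaximalSCCs_buState]

end DFForest

theorem mainTheorem4_general {V : Type*} [Finite V] (E : V → V → Prop) (D : DFForest V)
    (hD : D.IsDepthFirst E) :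
    (∃ W, ConstructWPOBU E D false W) ∧
    ∀ W, ConstructWPOBU E D false W →
      (ConstructWPOTD E D).verts = W.verts ∧
      (ConstructWPOTD E D).exits = W.exits ∧
      (ConstructWPOTD E D).stab = W.stab ∧
      (∀ a b : Node V,
        (¬ ∃ h, IsLoopedHead E D h ∧ a = Node.vtx h ∧ (b = Node.vtx h ∨ b = Node.exit h)) →
          ((ConstructWPOTD E D).sched a b ↔ W.sched a b)) ∧
      ((∀ h, ¬ IsLoopedHead E D h) → ConstructWPOTD E D = W) := by
  refine ⟨⟨_, hD.constructWPOBU_iff.2 rfl⟩, fun W hW => ?_⟩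
  obtain rfl := hD.constructWPOBU_iff.1 hW
  rw [hD.constructWPOTD_eq]
  have hsched (a b : Node V)
      (hab : ¬ ∃ h, IsLoopedHead E D h ∧ a = Node.vtx h ∧ (b = Node.vtx h ∨ b = Node.exit h)) :
      (D.closedWPO E (D.headSchedTD E)).sched a b ↔ (D.closedWPO E (D.headSched E)).sched a b :=
    or_congr_left <| exists_congr fun g =>
      DFForest.headSchedTD_iff_headSched fun h => hab ⟨g, h⟩
  refine ⟨rfl, rfl, rfl, hsched, fun hno => WPOTuple.ext rfl rfl ?_ rfl⟩
  funext a b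
  exact propext (hsched a b fun ⟨h, hl, _⟩ => hno h hl)

theorem mainTheorem4 {V : Type*} [Finite V] (E : V → V → Prop) (D : DFForest V)
    (hD : IsDFF E D) :
    (∃ W, ConstructWPOBU E D false W) ∧
    ∀ W, ConstructWPOBU E D false W →
      (ConstructWPOTD E D).verts = W.verts ∧
      (ConstructWPOTD E D).exits = W.exits ∧
      (ConstructWPOTD E D).stab = W.stab ∧
      (∀ a b : Node V,
        (¬ ∃ h, IsLoopedHead E D h ∧ a = Node.vtx h ∧ (b = Node.vtx h ∨ b = Node.exit h)) →
          ((ConstructWPOTD E D).sched a b ↔ W.sched a b)) ∧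
      ((∀ h, ¬ IsLoopedHead E D h) → ConstructWPOTD E D = W) :=
  mainTheorem4_general E D hD.isDepthFirst
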